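/- Let $M$ be a smooth scheme over $\mathbb C$ (for instance a smooth complex algebraic variety), let $i: D \hookrightarrow M$ be a closed subscheme that is smooth over $\mathbb C$, with ideal $I_D \subset \mathcal O_M$, let $W$ be a vector bundle (of finite rank) on $M$ and $L$ a vector bundle (of finite rank) on $D$, and let $\varepsilon: W \to L$ (that is, $W \to i_*L$) be a surjective morphism of $\mathcal O_M$-modules. Let $\mathcal N = I_D/I_D^2$ be the conormal bundle of $D$ in $M$, let $W_D$ be the restriction of $W$ to $D$, and let $K = \ker(W_D \to L)$. The morphism $\varepsilon$ induces a surjective morphism of graded algebras $\operatorname{Sym} W \to \operatorname{Sym} L$ (again denoted $\varepsilon$, where $\operatorname{Sym} L$ is formed over $\mathcal O_D$); let $I$ be its kernel, and let $J = I_D\cdot \operatorname{Sym} W \subseteq I$. For $p \ge 0$ and $q\ge 0$, let $F^q(I^p/I^{p+1})$ be the image of $J^q I^{p-q} \to I^p/I^{p+1}$ if $q \le p$, and $0$ if $q > p$. Then $F^\bullet$ is a decreasing filtration of $I^p/I^{p+1}$ by graded $\operatorname{Sym} L$-submodules, with $F^0 = I^p/I^{p+1}$ and $F^{p+1} = 0$,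 and its graded pieces $\operatorname{gr}_q = F^q/F^{q+1}$ are given by isomorphisms of sheaves of graded $\operatorname{Sym} L$-modules $$\operatorname{gr}_q(I^p/I^{p+1}) \;\cong\; S^q\mathcal N \otimes S^{p-q}K\,[-p+q] \otimes \operatorname{Sym} L \qquad (p \ge q \ge 0),$$ and $\operatorname{gr}_q(I^p/I^{p+1}) = 0$ for $q > p$. Here the tensor products are over $\mathcal O_D$, and the component of degree $d$ of the right-hand side is $S^q\mathcal N \otimes S^{p-q}K \otimes S^{d-p+q}L$ (zero if $d < p-q$). The isomorphism is the canonical one: for local sections $a_1,\dots,a_q$ of $I_D$, $w_1,\dots,w_{p-q}$ of $\ker(W \to L)$ and $s$ of $\operatorname{Sym} W$, the class of $a_1\cdots a_q\, w_1\cdots w_{p-q}\, s$ corresponds to $[a_1]\cdots[a_q] \otimes w_1|_D\cdots w_{p-q}|_D \otimes \varepsilon(s)$. (All these sheaves are quasi-coherent; they are described by their modules of sections over the affine opens of $M$, on which $\operatorname{Sym}$, tensor products, kernels, powers of ideals and quotients are those of modules, and an isomorphism of sheaves is a family of isomorphisms over the affine opens that is compatible with restriction to smaller affine opens.) -/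

import Mathlib

open CategoryTheory AlgebraicGeometry TensorProduct

noncomputable section

/-! ### Symmetric algebras and symmetric powers -/

/-- The ring homomorphism `Sym_R M → Sym_S N` induced by a ring homomorphism `σ : R → S` and a
`σ`-semilinear map `f : M → N`. -/
def symMap {R S M N : Type} [CommRing R] [CommRing S] [AddCommGroup M] [Module R M]
    [AddCommGroup N] [Module S N] (σ : R →+* S) (f : M →ₛₗ[σ] N) :
    SymmetricAlgebra R M →+* SymmetricAlgebra S N :=
  letI : Algebra R (SymmetricAlgebra S N) := ((algebraMap S (SymmetricAlgebra S N)).comp σ).toAlgebra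
  (SymmetricAlgebra.lift (R := R) (M := M) (A := SymmetricAlgebra S N)
    { toFun := fun m => SymmetricAlgebra.ι S N (f m)
      map_add' := fun x y => by simp
      map_smul' := fun r x => by
        rw [LinearMap.map_smulₛₗ, LinearMap.map_smul, Algebra.smul_def, Algebra.smul_def]
        rfl }).toRingHom

section symMap

variable {R S M N : Type} [CommRing R] [CommRing S] [AddCommGroup M] [Module R M]
    [AddCommGroup N] [Module S N] (σ : R →+* S) (f : M →ₛₗ[σ] N)

@[simp]
theorem symMap_ι (m : M) : symMap σ f (SymmetricAlgebra.ι R M m) = SymmetricAlgebra.ι S N (f m) := by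
  let _ : Algebra R (SymmetricAlgebra S N) :=
    ((algebraMap S (SymmetricAlgebra S N)).comp σ).toAlgebra
  exact SymmetricAlgebra.lift_ι_apply (R := R) (A := SymmetricAlgebra S N) _ m

@[simp]
theorem symMap_algebraMap (r : R) :
    symMap σ f (algebraMap R (SymmetricAlgebra R M) r) = algebraMap S (SymmetricAlgebra S N) (σ r) := by
  let _ : Algebra R (SymmetricAlgebra S N) :=
    ((algebraMap S (SymmetricAlgebra S N)).comp σ).toAlgebra
  exact AlgHom.commutes (SymmetricAlgebra.lift (R := R) (M := M) (A := SymmetricAlgebra S N) _) r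

/-- `symMap` as a semilinear map. -/
def symMapₛₗ : SymmetricAlgebra R M →ₛₗ[σ] SymmetricAlgebra S N where
  toFun := symMap σ f
  map_add' := map_add _
  map_smul' r x := by
    rw [Algebra.smul_def, Algebra.smul_def, map_mul, symMap_algebraMap]

end symMap

/-- The symmetric power `S^n M`, as the homogeneous component of degree `n` of `Sym_R M`: the
submodule spanned by the products of `n` elements of `M`. -/
def symPow (R M : Type) [CommRing R] [AddCommGroup M] [Module R M] (n : ℕ) :
    Submodule R (SymmetricAlgebra R M) :=
  LinearMap.range (SymmetricAlgebra.ι R M) ^ n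

/-- The product `m₁ ⋯ mₙ` in `S^n M`. -/
def symProd {R M : Type} [CommRing R] [AddCommGroup M] [Module R M] {n : ℕ} (m : Fin n → M) :
    symPow R M n :=
  ⟨∏ j, SymmetricAlgebra.ι R M (m j), by
    induction n with
    | zero => simp [symPow, Submodule.mem_one]
    | succ n ih =>
      rw [Fin.prod_univ_castSucc, symPow, pow_succ]
      exact Submodule.mul_mem_mul (ih fun j => m j.castSucc) ⟨_, rfl⟩⟩

/-- The restriction of a semilinear map to submodules. -/
def semilinearRestrict {R S M N : Type} [CommRing R] [CommRing S] [AddCommGroup M] [Module R M]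
    [AddCommGroup N] [Module S N] {σ : R →+* S} (f : M →ₛₗ[σ] N) (P : Submodule R M)
    (Q : Submodule S N) (h : ∀ x ∈ P, f x ∈ Q) : P →ₛₗ[σ] Q where
  toFun x := ⟨f x, h x x.2⟩
  map_add' x y := Subtype.ext (by simp)
  map_smul' r x := Subtype.ext (by simp)

theorem symMap_mem_symPow {R S M N : Type} [CommRing R] [CommRing S] [AddCommGroup M] [Module R M]
    [AddCommGroup N] [Module S N] (σ : R →+* S) (f : M →ₛₗ[σ] N) (n : ℕ) :
    ∀ x ∈ symPow R M n, symMapₛₗ σ f x ∈ symPow S N n := by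
  induction n with
  | zero =>
    intro x hx
    rw [symPow, pow_zero, Submodule.mem_one] at hx ⊢
    obtain ⟨r, rfl⟩ := hx
    exact ⟨σ r, (symMap_algebraMap σ f r).symm⟩
  | succ n ih =>
    intro x hx
    rw [symPow, pow_succ] at hx
    refine Submodule.mul_induction_on hx ?_ ?_
    · rintro a ha _ ⟨m, rfl⟩
      have : symMapₛₗ σ f (a * SymmetricAlgebra.ι R M m) =
          symMapₛₗ σ f a * SymmetricAlgebra.ι S N (f m) := by
        change symMap σ f _ = symMap σ f _ * _
        rw [map_mul, symMap_ι]
      rw [this, symPow, pow_succ]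
      exact Submodule.mul_mem_mul (ih a ha) ⟨_, rfl⟩
    · intro a b ha hb
      rw [map_add]
      exact Submodule.add_mem _ ha hb

/-- The map `S^n M → S^n N` induced by a semilinear map `M → N`. -/
def symPowMap {R S M N : Type} [CommRing R] [CommRing S] [AddCommGroup M] [Module R M]
    [AddCommGroup N] [Module S N] (σ : R →+* S) (f : M →ₛₗ[σ] N) (n : ℕ) :
    symPow R M n →ₛₗ[σ] symPow S N n :=
  semilinearRestrict (symMapₛₗ σ f) _ _ (symMap_mem_symPow σ f n)

/-! ### The situation over one affine open -/

/-- The sections over an affine open `U ⊆ M` of the data consisting of a closed subscheme `D ⊆ M`,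
a vector bundle `W` on `M`, a vector bundle `L` on `D` and a morphism `W → L`: the rings
`A = 𝒪_M(U)` and `B = 𝒪_D(D ∩ U)`, the modules `W(U)` and `L(D ∩ U)`, the restriction of functions
`φ : A → B` and the morphism `ε`. -/
structure BundleChart where
  A : Type
  B : Type
  W : Type
  L : Type
  [ringA : CommRing A]
  [ringB : CommRing B]
  [groupW : AddCommGroup W]
  [groupL : AddCommGroup L]
  [moduleW : Module A W]
  [moduleL : Module B L]
  φ : A →+* B
  ε : W →ₛₗ[φ] L

namespace BundleChart

attribute [instance] ringA ringB groupW groupL moduleW moduleL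

variable (X Y : BundleChart)

instance algebraAB : Algebra X.A X.B := X.φ.toAlgebra

instance moduleAL : Module X.A X.L := Module.compHom X.L X.φ

instance towerABL : IsScalarTower X.A X.B X.L where
  smul_assoc a b x := by
    change (X.φ a * b) • x = X.φ a • b • x
    rw [mul_smul]

/-- `ε` as a linear map over `A`. -/
def εA : X.W →ₗ[X.A] X.L where
  toFun := X.ε
  map_add' := map_add _
  map_smul' a w := X.ε.map_smulₛₗ a w

/-- The algebra `Sym W`. -/
abbrev SymW : Type := SymmetricAlgebra X.A X.W

/-- The algebra `Sym L`. -/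
abbrev SymL : Type := SymmetricAlgebra X.B X.L

/-- The morphism `Sym ε : Sym W → Sym L`. -/
def symε : X.SymW →+* X.SymL := symMap X.φ X.ε

/-- The ideal `I_D` of `D` in `M`. -/
def ID : Ideal X.A := RingHom.ker X.φ

/-- The ideal `I`, the kernel of `Sym W → Sym L`. -/
def I : Ideal X.SymW := RingHom.ker X.symε

/-- The ideal `J = I_D · Sym W`, the ideal of the total space of `W_D^*` in that of `W^*`. -/
def J : Ideal X.SymW := X.ID.map (algebraMap X.A X.SymW)

/-- The conormal bundle of `D` in `M`: the module `I_D / I_D²`, as a module over `B = 𝒪_D`. -/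
abbrev N : Type := X.B ⊗[X.A] X.ID.Cotangent

/-- The restriction `W_D` of `W` to `D`. -/
abbrev WD : Type := X.B ⊗[X.A] X.W

/-- The morphism `W_D → L` induced by `ε`. -/
def εD : X.WD →ₗ[X.B] X.L := X.εA.liftBaseChange X.B

/-- The kernel `K` of `W_D → L`. -/
def K : Submodule X.B X.WD := LinearMap.ker X.εD

/-- The quotient `I^p / I^{p+1}`. -/
abbrev Q (p : ℕ) : Type := ↥(X.I ^ p) ⧸ (X.I ^ (p + 1)).submoduleOf (X.I ^ p)

/-- The filtration of `I^p / I^{p+1}`: for `q ≤ p`, the term `F^q` is the image of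
`J^q I^{p-q} → I^p / I^{p+1}`, and for `q > p` it is `0`. -/
def F (p q : ℕ) : Submodule X.SymW (X.Q p) :=
  if q ≤ p then
    ((X.J ^ q * X.I ^ (p - q)).submoduleOf (X.I ^ p)).map
      ((X.I ^ (p + 1)).submoduleOf (X.I ^ p)).mkQ
  else ⊥

/-- The graded piece `gr_q (I^p / I^{p+1}) = F^q / F^{q+1}`. -/
abbrev Gr (p q : ℕ) : Type := ↥(X.F p q) ⧸ (X.F p (q + 1)).submoduleOf (X.F p q)

/-- The module `Sym L ⊗ (S^q N ⊗ S^{p-q} K)` over `Sym L`, for `q ≤ p`; all the tensor products are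
over `B = 𝒪_D`. -/
abbrev T (p q : ℕ) : Type := X.SymL ⊗[X.B] (symPow X.B X.N q ⊗[X.B] symPow X.B X.K (p - q))

/-! #### Gradings -/

/-- The homogeneous component of degree `d` of `I^p / I^{p+1}`, induced by that of `Sym W`. -/
def QDeg (p d : ℕ) : AddSubgroup (X.Q p) where
  carrier := {y | ∃ x : ↥(X.I ^ p), (x : X.SymW) ∈ symPow X.A X.W d ∧ Submodule.Quotient.mk x = y}
  zero_mem' := ⟨0, Submodule.zero_mem _, rfl⟩
  add_mem' := by
    rintro _ _ ⟨x, hx, rfl⟩ ⟨y, hy, rfl⟩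
    exact ⟨x + y, Submodule.add_mem _ hx hy, rfl⟩
  neg_mem' := by
    rintro _ ⟨x, hx, rfl⟩
    exact ⟨-x, Submodule.neg_mem _ hx, rfl⟩

/-- The homogeneous component of degree `d` of `gr_q (I^p / I^{p+1})`. -/
def GrDeg (p q d : ℕ) : AddSubgroup (X.Gr p q) where
  carrier := {y | ∃ x : ↥(X.F p q), (x : X.Q p) ∈ X.QDeg p d ∧ Submodule.Quotient.mk x = y}
  zero_mem' := ⟨0, AddSubgroup.zero_mem _, rfl⟩
  add_mem' := by
    rintro _ _ ⟨x, hx, rfl⟩ ⟨y, hy, rfl⟩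
    exact ⟨x + y, AddSubgroup.add_mem _ hx hy, rfl⟩
  neg_mem' := by
    rintro _ ⟨x, hx, rfl⟩
    exact ⟨-x, AddSubgroup.neg_mem _ hx, rfl⟩

/-- The homogeneous component of degree `d` of `S^q N ⊗ S^{p-q} K [-p+q] ⊗ Sym L`, that is
`S^q N ⊗ S^{p-q} K ⊗ S^{d-(p-q)} L` (which is `0` for `d < p - q`). -/
def TDeg (p q d : ℕ) : AddSubgroup (X.T p q) :=
  AddSubgroup.closure
    {x | ∃ e, e + (p - q) = d ∧ ∃ t ∈ symPow X.B X.L e, ∃ y, x = t ⊗ₜ[X.B] y}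

/-! #### Generators -/

variable {X}

/-- The class of `a ∈ I_D` in the conormal bundle. -/
def toN (a : X.ID) : X.N := 1 ⊗ₜ[X.A] X.ID.toCotangent a

/-- The section of `K` defined by `w ∈ W` with `ε w = 0`. -/
def toK (w : LinearMap.ker X.ε) : X.K :=
  ⟨1 ⊗ₜ[X.A] (w : X.W), by
    have h : X.ε (w : X.W) = 0 := w.2
    change X.εA.liftBaseChange X.B _ = 0
    rw [LinearMap.liftBaseChange_tmul]
    change (1 : X.B) • X.ε (w : X.W) = 0
    rw [h, smul_zero]⟩

theorem J_le_I : X.J ≤ X.I := by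
  rw [J, Ideal.map_le_iff_le_comap]
  intro a ha
  have h : X.φ a = 0 := ha
  change symMap X.φ X.ε _ = 0
  rw [symMap_algebraMap, h, map_zero]

theorem J_pow_mul_le {p q : ℕ} (h : q ≤ p) : X.J ^ q * X.I ^ (p - q) ≤ X.I ^ p := by
  calc X.J ^ q * X.I ^ (p - q) ≤ X.I ^ q * X.I ^ (p - q) :=
        Ideal.mul_mono_left (Ideal.pow_right_mono J_le_I q)
    _ = X.I ^ p := by rw [← pow_add, Nat.add_sub_cancel' h]

/-- The class in `gr_q (I^p / I^{p+1})` of an element of `J^q I^{p-q}`. -/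
def grClass {p q : ℕ} (h : q ≤ p) (x : X.SymW) (hx : x ∈ X.J ^ q * X.I ^ (p - q)) : X.Gr p q :=
  Submodule.Quotient.mk
    ⟨Submodule.Quotient.mk ⟨x, J_pow_mul_le h hx⟩, by
      rw [F, if_pos h]
      exact ⟨⟨x, J_pow_mul_le h hx⟩, hx, rfl⟩⟩

theorem generator_mem {p q : ℕ} (a : Fin q → X.ID) (w : Fin (p - q) → LinearMap.ker X.ε)
    (s : X.SymW) :
    (∏ j, algebraMap X.A X.SymW (a j)) *
      (∏ j, SymmetricAlgebra.ι X.A X.W (w j)) * s ∈ X.J ^ q * X.I ^ (p - q) := by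
  refine Ideal.mul_mem_right _ _ (Ideal.mul_mem_mul ?_ ?_)
  · have h := Ideal.prod_mem_prod (s := (Finset.univ : Finset (Fin q))) (I := fun _ => X.J)
      (x := fun j => algebraMap X.A X.SymW (a j)) (fun j _ => Ideal.mem_map_of_mem _ (a j).2)
    simpa using h
  · have h := Ideal.prod_mem_prod (s := (Finset.univ : Finset (Fin (p - q)))) (I := fun _ => X.I)
      (x := fun j => SymmetricAlgebra.ι X.A X.W (w j)) (fun j _ => by
        change symMap X.φ X.ε _ = 0
        have hw : X.ε (w j : X.W) = 0 := (w j).2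
        rw [symMap_ι, hw, map_zero])
    simpa using h

/-- The class in `gr_q (I^p / I^{p+1})` of `a₁ ⋯ a_q w₁ ⋯ w_{p-q} s`, with `aⱼ ∈ I_D`, with `wⱼ ∈ W`
such that `ε wⱼ = 0`, and with `s ∈ Sym W`. -/
def grGenerator {p q : ℕ} (h : q ≤ p) (a : Fin q → X.ID) (w : Fin (p - q) → LinearMap.ker X.ε)
    (s : X.SymW) : X.Gr p q :=
  grClass h _ (generator_mem a w s)

/-! #### Restriction to a smaller affine open -/

/-- The restriction maps to a smaller affine open. -/
structure Hom (X Y : BundleChart) where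
  fA : X.A →+* Y.A
  fB : X.B →+* Y.B
  fW : X.W →ₛₗ[fA] Y.W
  fL : X.L →ₛₗ[fB] Y.L
  comm_φ : ∀ a, Y.φ (fA a) = fB (X.φ a)
  comm_ε : ∀ w, Y.ε (fW w) = fL (X.ε w)

namespace Hom

variable {X Y : BundleChart} (f : Hom X Y)

/-- The restriction map of `Sym W`. -/
def symW : X.SymW →+* Y.SymW := symMap f.fA f.fW

/-- The restriction map of `Sym L`. -/
def symL : X.SymL →+* Y.SymL := symMap f.fB f.fL

theorem symε_symW (s : X.SymW) : Y.symε (f.symW s) = f.symL (X.symε s) := by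
  induction s using SymmetricAlgebra.induction with
  | algebraMap r => simp [symε, symW, symL, f.comm_φ]
  | ι w => simp [symε, symW, symL, f.comm_ε]
  | mul a b ha hb => simp only [map_mul, ha, hb]
  | add a b ha hb => simp only [map_add, ha, hb]

theorem map_I : X.I.map f.symW ≤ Y.I := by
  rw [Ideal.map_le_iff_le_comap]
  intro s hs
  have h : X.symε s = 0 := hs
  change Y.symε (f.symW s) = 0
  rw [symε_symW, h, map_zero]

theorem ID_le : X.ID ≤ Y.ID.comap f.fA := by
  intro a ha
  have h : X.φ a = 0 := ha
  change Y.φ (f.fA a) = 0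
  rw [f.comm_φ, h, map_zero]

theorem map_J : X.J.map f.symW ≤ Y.J := by
  rw [J, Ideal.map_map, Ideal.map_le_iff_le_comap]
  intro a ha
  change symMap f.fA f.fW (algebraMap _ _ a) ∈ Y.J
  rw [symMap_algebraMap]
  exact Ideal.mem_map_of_mem _ (f.ID_le ha)

theorem symW_mem_I_pow {p : ℕ} {x : X.SymW} (hx : x ∈ X.I ^ p) : f.symW x ∈ Y.I ^ p := by
  have h := Ideal.mem_map_of_mem f.symW hx
  rw [Ideal.map_pow] at h
  exact Ideal.pow_right_mono f.map_I p h

theorem symW_mem_J_pow_mul {q r : ℕ} {x : X.SymW} (hx : x ∈ X.J ^ q * X.I ^ r) :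
    f.symW x ∈ Y.J ^ q * Y.I ^ r := by
  have h := Ideal.mem_map_of_mem f.symW hx
  rw [Ideal.map_mul, Ideal.map_pow, Ideal.map_pow] at h
  exact Ideal.mul_mono (Ideal.pow_right_mono f.map_J q) (Ideal.pow_right_mono f.map_I r) h

/-- The restriction map of `Sym W`, as a semilinear map over itself. -/
def symWₛₗ : X.SymW →ₛₗ[f.symW] Y.SymW where
  toFun := f.symW
  map_add' := map_add _
  map_smul' r x := by simp

/-- The restriction map of `I^p / I^{p+1}`. -/
def resQ (p : ℕ) : X.Q p →ₛₗ[f.symW] Y.Q p :=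
  Submodule.mapQ _ _
    (semilinearRestrict f.symWₛₗ (X.I ^ p) (Y.I ^ p) (fun _ hx => f.symW_mem_I_pow hx))
    (by
      intro x hx
      change f.symW (x : X.SymW) ∈ Y.I ^ (p + 1)
      exact f.symW_mem_I_pow hx)

theorem resQ_mk (p : ℕ) (x : ↥(X.I ^ p)) :
    f.resQ p (Submodule.Quotient.mk x) =
      Submodule.Quotient.mk ⟨f.symW x, f.symW_mem_I_pow x.2⟩ := by
  rfl

theorem resQ_mem_F (p q : ℕ) : ∀ x ∈ X.F p q, f.resQ p x ∈ Y.F p q := by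
  intro x hx
  by_cases h : q ≤ p
  · rw [F, if_pos h] at hx ⊢
    obtain ⟨y, hy, rfl⟩ := hx
    exact ⟨⟨f.symW y, f.symW_mem_I_pow y.2⟩, f.symW_mem_J_pow_mul hy, (f.resQ_mk p y).symm⟩
  · rw [F, if_neg h, Submodule.mem_bot] at hx ⊢
    rw [hx, map_zero]

/-- The restriction map of `gr_q (I^p / I^{p+1})`. -/
def resGr (p q : ℕ) : X.Gr p q →ₛₗ[f.symW] Y.Gr p q :=
  Submodule.mapQ _ _ (semilinearRestrict (f.resQ p) _ _ (f.resQ_mem_F p q))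
    (fun x hx => f.resQ_mem_F p (q + 1) x hx)

/-- The restriction map of `𝒪_D`, semilinear over that of `𝒪_M`. -/
def fBA : X.B →ₛₗ[f.fA] Y.B where
  toFun := f.fB
  map_add' := map_add _
  map_smul' a b := by
    change f.fB (X.φ a * b) = Y.φ (f.fA a) * f.fB b
    rw [map_mul, f.comm_φ]

/-- The restriction map of the pullback to `D` of a module on `M`. -/
def resBaseChange {P P' : Type} [AddCommGroup P] [Module X.A P] [AddCommGroup P'] [Module Y.A P']
    (g : P →ₛₗ[f.fA] P') : X.B ⊗[X.A] P →ₛₗ[f.fB] Y.B ⊗[Y.A] P' where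
  toFun := TensorProduct.map f.fBA g
  map_add' := map_add _
  map_smul' b x := by
    induction x using TensorProduct.induction_on with
    | zero => simp
    | tmul c y =>
      rw [TensorProduct.smul_tmul', TensorProduct.map_tmul, TensorProduct.map_tmul,
        TensorProduct.smul_tmul']
      congr 1
      exact map_mul f.fB b c
    | add x y hx hy => rw [smul_add, map_add, hx, hy, map_add, smul_add]

/-- The restriction map of `I_D / I_D²`. -/
def resCotangent : X.ID.Cotangent →ₛₗ[f.fA] Y.ID.Cotangent where
  toFun := Ideal.mapCotangent X.ID Y.ID f.fA.toIntAlgHom f.ID_le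
  map_add' := map_add _
  map_smul' a x := by
    obtain ⟨y, rfl⟩ := X.ID.toCotangent_surjective x
    rw [← map_smul]
    change Y.ID.toCotangent _ = f.fA a • Y.ID.toCotangent _
    rw [← map_smul]
    congr 1
    exact Subtype.ext (map_mul f.fA a y)

/-- The restriction map of the conormal bundle. -/
def resN : X.N →ₛₗ[f.fB] Y.N := f.resBaseChange f.resCotangent

/-- The restriction map of `W_D`. -/
def resWD : X.WD →ₛₗ[f.fB] Y.WD := f.resBaseChange f.fW

theorem εD_resWD (x : X.WD) : Y.εD (f.resWD x) = f.fL (X.εD x) := by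
  induction x using TensorProduct.induction_on with
  | zero => simp
  | tmul b w =>
    change Y.εA.liftBaseChange Y.B (f.fB b ⊗ₜ f.fW w) = f.fL (X.εA.liftBaseChange X.B (b ⊗ₜ w))
    rw [LinearMap.liftBaseChange_tmul, LinearMap.liftBaseChange_tmul, LinearMap.map_smulₛₗ]
    congr 1
    exact f.comm_ε w
  | add x y hx hy => simp only [map_add, hx, hy]

/-- The restriction map of `K`. -/
def resK : X.K →ₛₗ[f.fB] Y.K :=
  semilinearRestrict f.resWD X.K Y.K (fun x hx => by
    have h : X.εD x = 0 := hx
    change Y.εD (f.resWD x) = 0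
    rw [εD_resWD, h, map_zero])

/-- The restriction map of `Sym L ⊗ (S^q N ⊗ S^{p-q} K)`. -/
def resT (p q : ℕ) : X.T p q →ₛₗ[f.fB] Y.T p q :=
  TensorProduct.map (symMapₛₗ f.fB f.fL)
    (TensorProduct.map (symPowMap f.fB f.resN q) (symPowMap (M := X.K) (N := Y.K) f.fB f.resK (p - q)))

end Hom

end BundleChart

/-! ### The data on a scheme -/

/-- A vector bundle on a scheme: a sheaf of modules that is locally free of finite rank. -/
def IsVectorBundle {X : Scheme.{0}} (E : X.Modules) : Prop :=
  ∃ q : SheafOfModules.LocalGeneratorsData.{0} (R := X.ringCatSheaf) E,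
    q.IsLocallyFreeData ∧ q.IsFiniteType

variable {M D : Scheme.{0}} (i : D ⟶ M) (W : M.Modules) (L : D.Modules)
  (ε : W ⟶ (Scheme.Modules.pushforward i).obj L)

/-- The sections of the data `(𝒪_M → 𝒪_D, ε : W → L)` over an open `U` of `M`. The sheaves on `M` and
on `D` built from these data (`Sym W`, `Sym L`, `I`, `N`, `K`, `I^p / I^{p+1}` with its filtration, …)
are quasi-coherent, and their sections over the affine opens `U` are obtained by applying the
corresponding constructions for modules to the sections over `U`. -/
def bundleChart (U : M.Opens) : BundleChart where
  A := Γ(M, U)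
  B := Γ(D, i ⁻¹ᵁ U)
  W := Γ(W, U)
  L := Γ(L, i ⁻¹ᵁ U)
  φ := (i.app U).hom
  ε :=
    { toFun := fun w => ε.app U w
      map_add' := fun x y => map_add (ε.app U).hom x y
      map_smul' := fun a w => ε.app_smul a w }

/-- The restriction maps from the sections over `U` to the sections over `V ⊆ U`. -/
def bundleRes {U V : M.Opens} (h : V ≤ U) :
    BundleChart.Hom (bundleChart i W L ε U) (bundleChart i W L ε V) where
  fA := (M.presheaf.map (homOfLE h).op).hom
  fB := (D.presheaf.map ((TopologicalSpace.Opens.map i.base).map (homOfLE h)).op).hom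
  fW :=
    { toFun := fun w => W.presheaf.map (homOfLE h).op w
      map_add' := fun x y => map_add (W.presheaf.map (homOfLE h).op).hom x y
      map_smul' := fun a w => W.map_smul (homOfLE h) a w }
  fL :=
    { toFun := fun l => L.presheaf.map ((TopologicalSpace.Opens.map i.base).map (homOfLE h)).op l
      map_add' := fun x y =>
        map_add (L.presheaf.map ((TopologicalSpace.Opens.map i.base).map (homOfLE h)).op).hom x y
      map_smul' := fun a l =>
        L.map_smul ((TopologicalSpace.Opens.map i.base).map (homOfLE h)) a l }
  comm_φ a := congrArg (fun g => g.hom a) (i.naturality (homOfLE h).op)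
  comm_ε w := ConcreteCategory.congr_hom (ε.mapPresheaf.naturality (homOfLE h).op) w

end

/-!
Everything is checked on an affine open `U = Spec A` of `M`, with `D ∩ U = Spec B`. The isomorphism
is determined by its values on the generators `a₁ ⋯ a_q w₁ ⋯ w_{p-q} s`
(`BundleChart.T_induction`), so its linearity, its compatibility with the gradings and its
compatibility with restriction to smaller affine opens follow from those values
(`BundleChart.iso_smul`, `BundleChart.iso_mem_GrDeg`, `BundleChart.Hom.iso_resT`). It remains to see
that it exists over each `U`.

Geometrically, `I` is the ideal of `V(L) = Spec Sym L` in `V(W) = Spec Sym W`, and the smoothness of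
`M` and `D` makes `V(W)` look like the spectrum of `Sym L ⊗ Sym N ⊗ Sym K` along `V(L)`, to any finite
order. This is used in two ways, which give maps in both directions.

* As `A` and `B` are formally smooth, the conormal sequence splits and there is a derivation
  `D : A → N` extending `I_D → N`. The ring homomorphism `a ↦ φ a + D a` to the first-order
  neighbourhood lifts to a neighbourhood of any order, because `A` is formally smooth, and
  `w ↦ ρ w + ε w`, for a projection `ρ` of `W_D` onto `K`, extends it to `Sym W`, because `W` is
  projective (`BundleChart.exists_expansion`). Taking the component in `Sym L ⊗ (S^q N ⊗ S^{p-q} K)`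
  gives a map `g` on `Sym W` with the expected values on the generators, which vanishes on
  `H = J^{q+1} I^{p-q-1} + I^{p+1}`, or on `H = I^{p+1}` if `q = p`
  (`BundleChart.exists_leadingTerm`).
* As `B` is formally smooth, `B → Sym W / J` lifts to a ring homomorphism `B → Sym W / H`
  (`BundleChart.exists_section`). As `N`, `K` and `L` are projective over `B`, they map to
  `Sym W / H` compatibly with the given generators, and multiplication gives a map `τ` from
  `Sym L ⊗ (S^q N ⊗ S^{p-q} K)` to `Sym W / H` (`BundleChart.exists_multiplication`).

The choices made do not affect the values on the generators, since a product
`a₁ ⋯ a_q w₁ ⋯ w_{p-q} s` only changes by an element of `H` when the `aⱼ` are changed modulo `J²`,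
the `wⱼ` modulo `J` and `s` modulo `I` (`prod_mul_prod_mul_sub_mem`). Because `J^q I^{p-q}` is
generated by such products together with `H ∩ J^q I^{p-q}` (`BundleChart.mul_induction`), `τ ∘ g` is
the projection on `J^q I^{p-q}`. So `g` induces a bijection from `gr_q` to
`Sym L ⊗ (S^q N ⊗ S^{p-q} K)` (`BundleChart.exists_iso_of_maps`).

The hypotheses on the charts come from the geometry: `W(U)` and `L(D ∩ U)` are projective, being
locally free (`IsAffineOpen.projective_of_isVectorBundle`), and `W(U) → L(D ∩ U)` is surjective,
because sections of quasi-coherent sheaves over affine opens localize and `tilde` is faithful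
(`IsAffineOpen.surjective_app`).
-/

noncomputable section

/-! ### Homogeneous components of elements and ideals of a symmetric algebra -/

namespace SymmetricAlgebra

section Grading

variable {R M : Type} [CommRing R] [AddCommGroup M] [Module R M]

variable (R M) in
/-- The coaction `Sym M → (Sym M)[t]`, `m ↦ m t`, whose coefficients are the homogeneous components
of an element of `Sym M`. -/
def coaction : SymmetricAlgebra R M →ₐ[R] Polynomial (SymmetricAlgebra R M) :=
  SymmetricAlgebra.lift (((Polynomial.monomial 1).restrictScalars R) ∘ₗ SymmetricAlgebra.ι R M)

theorem coaction_ι (m : M) : coaction R M (ι R M m) = Polynomial.monomial 1 (ι R M m) :=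
  SymmetricAlgebra.lift_ι_apply _ m

theorem coaction_algebraMap (r : R) :
    coaction R M (algebraMap R _ r) = Polynomial.C (algebraMap R _ r) :=
  AlgHom.commutes _ r

/-- The homogeneous component of degree `d` of an element of `Sym M`. -/
def component (d : ℕ) : SymmetricAlgebra R M →ₗ[R] SymmetricAlgebra R M :=
  ((Polynomial.lcoeff (SymmetricAlgebra R M) d).restrictScalars R) ∘ₗ (coaction R M).toLinearMap

theorem component_apply (d : ℕ) (x : SymmetricAlgebra R M) :
    component d x = (coaction R M x).coeff d := rfl

theorem symPow_mul_mem {m n : ℕ} {x y : SymmetricAlgebra R M} (hx : x ∈ symPow R M m)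
    (hy : y ∈ symPow R M n) : x * y ∈ symPow R M (m + n) := by
  rw [symPow, pow_add]
  exact Submodule.mul_mem_mul hx hy

theorem ι_mem_symPow (m : M) : ι R M m ∈ symPow R M 1 := by
  rw [symPow, pow_one]
  exact ⟨m, rfl⟩

theorem algebraMap_mem_symPow (r : R) : algebraMap R _ r ∈ symPow R M 0 := by
  rw [symPow, pow_zero, Submodule.mem_one]
  exact ⟨r, rfl⟩

theorem coaction_of_mem_symPow {n : ℕ} {x : SymmetricAlgebra R M} (hx : x ∈ symPow R M n) :
    coaction R M x = Polynomial.monomial n x := by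
  induction n generalizing x with
  | zero =>
    rw [symPow, pow_zero, Submodule.mem_one] at hx
    obtain ⟨r, rfl⟩ := hx
    exact coaction_algebraMap r
  | succ n ih =>
    rw [symPow, pow_succ] at hx
    refine Submodule.mul_induction_on hx ?_ ?_
    · rintro a ha _ ⟨m, rfl⟩
      rw [map_mul, ih ha, coaction_ι, Polynomial.monomial_mul_monomial]
    · intro a b ha hb
      rw [map_add, map_add, ha, hb]

theorem component_of_mem {n : ℕ} {x : SymmetricAlgebra R M} (hx : x ∈ symPow R M n) :
    component n x = x := by
  rw [component_apply, coaction_of_mem_symPow hx, Polynomial.coeff_monomial_same]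

theorem component_of_mem_of_ne {n d : ℕ} (h : n ≠ d) {x : SymmetricAlgebra R M}
    (hx : x ∈ symPow R M n) : component d x = 0 := by
  rw [component_apply, coaction_of_mem_symPow hx, Polynomial.coeff_monomial_of_ne _ h.symm]

theorem component_mul (d : ℕ) (x y : SymmetricAlgebra R M) :
    component d (x * y) =
      ∑ e ∈ Finset.HasAntidiagonal.antidiagonal d, component e.1 x * component e.2 y := by
  simp only [component_apply, map_mul, Polynomial.coeff_mul]

theorem component_mem (d : ℕ) (x : SymmetricAlgebra R M) : component d x ∈ symPow R M d := by
  induction x using SymmetricAlgebra.induction generalizing d with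
  | algebraMap r =>
    rcases eq_or_ne 0 d with rfl | h
    · rw [component_of_mem (algebraMap_mem_symPow r)]
      exact algebraMap_mem_symPow r
    · rw [component_of_mem_of_ne h (algebraMap_mem_symPow r)]
      exact Submodule.zero_mem _
  | ι m =>
    rcases eq_or_ne 1 d with rfl | h
    · rw [component_of_mem (ι_mem_symPow m)]
      exact ι_mem_symPow m
    · rw [component_of_mem_of_ne h (ι_mem_symPow m)]
      exact Submodule.zero_mem _
  | mul a b ha hb =>
    rw [component_mul]
    refine Submodule.sum_mem _ fun e he => ?_
    rw [← Finset.HasAntidiagonal.mem_antidiagonal.mp he]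
    exact symPow_mul_mem (ha _) (hb _)
  | add a b ha hb =>
    rw [map_add]
    exact Submodule.add_mem _ (ha d) (hb d)

/-- An element of `Sym M` is the sum of its homogeneous components: the coaction followed by
evaluation at `1` is the identity. -/
theorem sum_component (x : SymmetricAlgebra R M) :
    ∑ d ∈ (coaction R M x).support, component d x = x := by
  have h : ((Polynomial.aeval (R := SymmetricAlgebra R M) (1 : SymmetricAlgebra R M)).restrictScalars
      R).comp (coaction R M) = AlgHom.id R _ := by
    refine SymmetricAlgebra.algHom_ext (LinearMap.ext fun m => ?_)
    simp [coaction_ι]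
  have h' := AlgHom.congr_fun h x
  simp only [AlgHom.coe_comp, Function.comp_apply, AlgHom.coe_restrictScalars', AlgHom.id_apply,
    Polynomial.aeval_eq_sum_range, one_pow, smul_eq_mul, mul_one] at h'
  conv_rhs => rw [← h']
  refine Finset.sum_subset (fun d hd => ?_) (fun d _ hd => ?_)
  · exact Finset.mem_range_succ_iff.mpr (Polynomial.le_natDegree_of_mem_supp d hd)
  · exact Polynomial.notMem_support_iff.mp hd

/-- The projection of `Sym M` onto the symmetric power `S^d M`. -/
def projPow (d : ℕ) : SymmetricAlgebra R M →ₗ[R] symPow R M d :=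
  (component d).codRestrict _ (component_mem d)

theorem projPow_coe {d : ℕ} (x : symPow R M d) : projPow d (x : SymmetricAlgebra R M) = x :=
  Subtype.ext (component_of_mem x.2)

variable (R M) in
/-- The augmentation ideal of `Sym M`. -/
def augIdeal : Ideal (SymmetricAlgebra R M) := Ideal.span (Set.range (ι R M))

theorem ι_mem_augIdeal (m : M) : ι R M m ∈ augIdeal R M := Ideal.subset_span ⟨m, rfl⟩

/-- The elements of the `n`-th power of the augmentation ideal have no components of degree `< n`:
their images under the coaction are divisible by `t ^ n`. -/
theorem projPow_eq_zero {n d : ℕ} (h : d < n) {x : SymmetricAlgebra R M}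
    (hx : x ∈ augIdeal R M ^ n) : projPow d x = 0 := by
  have h1 : augIdeal R M ≤ (Ideal.span {Polynomial.X}).comap (coaction R M) := by
    rw [augIdeal, Ideal.span_le]
    rintro _ ⟨m, rfl⟩
    change coaction R M (ι R M m) ∈ Ideal.span {Polynomial.X}
    rw [coaction_ι, Ideal.mem_span_singleton]
    exact ⟨Polynomial.C (ι R M m), by rw [mul_comm, Polynomial.C_mul_X_eq_monomial]⟩
  have h2 := Ideal.le_comap_pow _ n (Ideal.pow_right_mono h1 n hx)
  rw [Ideal.mem_comap, Ideal.span_singleton_pow, Ideal.mem_span_singleton,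
    Polynomial.X_pow_dvd_iff] at h2
  exact Subtype.ext (h2 d h)

/-- An ideal of `Sym M` is homogeneous if it contains the components of its elements. -/
def IsHomogeneous (𝔞 : Ideal (SymmetricAlgebra R M)) : Prop :=
  ∀ x ∈ 𝔞, ∀ d, component d x ∈ 𝔞

/-- Homogeneity means that the coaction maps `𝔞` to `𝔞[t]`; in this form the stability under
products, powers and sums is immediate. -/
theorem isHomogeneous_iff_map_le {𝔞 : Ideal (SymmetricAlgebra R M)} :
    IsHomogeneous 𝔞 ↔ 𝔞.map (coaction R M) ≤ 𝔞.map Polynomial.C := by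
  rw [Ideal.map_le_iff_le_comap]
  exact forall₂_congr fun x _ => (Ideal.mem_map_C_iff (f := coaction R M x)).symm

theorem IsHomogeneous.mul {𝔞 𝔟 : Ideal (SymmetricAlgebra R M)} (ha : IsHomogeneous 𝔞)
    (hb : IsHomogeneous 𝔟) : IsHomogeneous (𝔞 * 𝔟) := by
  rw [isHomogeneous_iff_map_le] at *
  rw [Ideal.map_mul, Ideal.map_mul]
  exact Ideal.mul_mono ha hb

theorem IsHomogeneous.pow {𝔞 : Ideal (SymmetricAlgebra R M)} (ha : IsHomogeneous 𝔞) (n : ℕ) :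
    IsHomogeneous (𝔞 ^ n) := by
  rw [isHomogeneous_iff_map_le] at *
  rw [Ideal.map_pow, Ideal.map_pow]
  exact Ideal.pow_right_mono ha n

theorem IsHomogeneous.sup {𝔞 𝔟 : Ideal (SymmetricAlgebra R M)} (ha : IsHomogeneous 𝔞)
    (hb : IsHomogeneous 𝔟) : IsHomogeneous (𝔞 ⊔ 𝔟) := by
  rw [isHomogeneous_iff_map_le] at *
  rw [Ideal.map_sup, Ideal.map_sup]
  exact sup_le_sup ha hb

theorem isHomogeneous_map_algebraMap (𝔞 : Ideal R) :
    IsHomogeneous (𝔞.map (algebraMap R (SymmetricAlgebra R M))) := by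
  rw [isHomogeneous_iff_map_le, Ideal.map_le_iff_le_comap, Ideal.map_le_iff_le_comap]
  intro a ha
  change coaction R M (algebraMap R _ a) ∈
    (𝔞.map (algebraMap R (SymmetricAlgebra R M))).map Polynomial.C
  rw [coaction_algebraMap]
  exact Ideal.mem_map_of_mem _ (Ideal.mem_map_of_mem _ ha)

/-- The products `m₁ ⋯ mₙ` generate `S^n M`. -/
theorem span_symProd (n : ℕ) :
    Submodule.span R (Set.range (symProd : (Fin n → M) → symPow R M n)) = ⊤ := by
  rw [eq_top_iff]
  rintro ⟨x, hx⟩ -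
  induction n generalizing x with
  | zero =>
    obtain ⟨r, rfl⟩ := Submodule.mem_one.mp (by simpa only [symPow, pow_zero] using hx)
    have : (⟨algebraMap R _ r, hx⟩ : symPow R M 0) = r • symProd (fun j : Fin 0 => j.elim0) :=
      Subtype.ext (by simp [symProd, Algebra.algebraMap_eq_smul_one])
    rw [this]
    exact Submodule.smul_mem _ _ (Submodule.subset_span ⟨_, rfl⟩)
  | succ n ih =>
    have hx' := hx
    rw [symPow, pow_succ] at hx'
    refine Submodule.mul_induction_on' (C := fun x hx' => ∀ hx : x ∈ symPow R M (n + 1),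
      (⟨x, hx⟩ : symPow R M (n + 1)) ∈ Submodule.span R (Set.range symProd)) ?_ ?_ hx' hx
    · rintro a ha _ ⟨m, rfl⟩ h
      let f : symPow R M n →ₗ[R] symPow R M (n + 1) :=
        ((LinearMap.mulRight R (ι R M m)).domRestrict _).codRestrict _ fun y =>
          symPow_mul_mem y.2 (ι_mem_symPow m)
      have h1 : f ⟨a, ha⟩ ∈ (Submodule.span R (Set.range symProd)).map f :=
        Submodule.mem_map_of_mem (ih a ha)
      rw [Submodule.map_span] at h1
      refine Submodule.span_mono ?_ h1
      rintro _ ⟨_, ⟨w, rfl⟩, rfl⟩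
      refine ⟨Fin.snoc w m, Subtype.ext ?_⟩
      change ∏ j, ι R M (Fin.snoc (α := fun _ => M) w m j) = (∏ j, ι R M (w j)) * ι R M m
      rw [Fin.prod_univ_castSucc]
      simp
    · intro a ha b hb iha ihb h
      exact Submodule.add_mem _ (iha ha) (ihb hb)

end Grading

section symMap

variable {R S M N : Type} [CommRing R] [CommRing S] [AddCommGroup M] [Module R M]
    [AddCommGroup N] [Module S N] (σ : R →+* S) (f : M →ₛₗ[σ] N)

theorem coaction_symMap (x : SymmetricAlgebra R M) :
    coaction S N (symMap σ f x) = (coaction R M x).map (symMap σ f) := by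
  induction x using SymmetricAlgebra.induction with
  | algebraMap r => rw [symMap_algebraMap, coaction_algebraMap, coaction_algebraMap,
      Polynomial.map_C, symMap_algebraMap]
  | ι m => rw [symMap_ι, coaction_ι, coaction_ι, Polynomial.map_monomial, symMap_ι]
  | mul a b ha hb => rw [map_mul, map_mul, ha, hb, map_mul, Polynomial.map_mul]
  | add a b ha hb => rw [map_add, map_add, ha, hb, map_add, Polynomial.map_add]

theorem component_symMap (d : ℕ) (x : SymmetricAlgebra R M) :
    component d (symMap σ f x) = symMap σ f (component d x) := by
  rw [component_apply, coaction_symMap, Polynomial.coeff_map, component_apply]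

theorem isHomogeneous_ker_symMap : IsHomogeneous (RingHom.ker (symMap σ f)) := by
  intro x hx d
  rw [RingHom.mem_ker] at hx ⊢
  rw [← component_symMap, hx, map_zero]

theorem symMap_surjective (hσ : Function.Surjective σ) (hf : Function.Surjective f) :
    Function.Surjective (symMap σ f) := by
  intro y
  induction y using SymmetricAlgebra.induction with
  | algebraMap s =>
    obtain ⟨r, rfl⟩ := hσ s
    exact ⟨algebraMap R _ r, symMap_algebraMap σ f r⟩
  | ι n =>
    obtain ⟨m, rfl⟩ := hf n
    exact ⟨ι R M m, symMap_ι σ f m⟩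
  | mul a b ha hb =>
    obtain ⟨x, rfl⟩ := ha
    obtain ⟨y, rfl⟩ := hb
    exact ⟨x * y, map_mul _ x y⟩
  | add a b ha hb =>
    obtain ⟨x, rfl⟩ := ha
    obtain ⟨y, rfl⟩ := hb
    exact ⟨x + y, map_add _ x y⟩

end symMap

end SymmetricAlgebra

/-! ### Products of ideals and generators of `J ^ q I ^ r` -/

section Ideals

variable {S S' : Type*} [CommRing S] [CommRing S']

/-- For ideals `𝔫 ≤ 𝔪`, the ideal `𝔫 ^ (q + 1) 𝔪 ^ (r - 1) + 𝔪 ^ (q + r + 1)` (just `𝔪 ^ (q + 1)` if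
`r = 0`): modulo `𝔪 ^ (q + r + 1)`, the term after `𝔫 ^ q 𝔪 ^ r` in the filtration of
`𝔪 ^ (q + r)` by powers of `𝔫`. -/
def nextTerm (𝔫 𝔪 : Ideal S) (q : ℕ) : ℕ → Ideal S
  | 0 => 𝔪 ^ (q + 1)
  | r + 1 => 𝔫 ^ (q + 1) * 𝔪 ^ r ⊔ 𝔪 ^ (q + r + 2)

theorem map_nextTerm (f : S →+* S') (𝔫 𝔪 : Ideal S) (q r : ℕ) :
    (nextTerm 𝔫 𝔪 q r).map f = nextTerm (𝔫.map f) (𝔪.map f) q r := by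
  cases r <;> simp [nextTerm, Ideal.map_sup, Ideal.map_mul, Ideal.map_pow]

theorem nextTerm_mono {𝔫 𝔪 𝔫' 𝔪' : Ideal S} (hn : 𝔫 ≤ 𝔫') (hm : 𝔪 ≤ 𝔪') (q r : ℕ) :
    nextTerm 𝔫 𝔪 q r ≤ nextTerm 𝔫' 𝔪' q r := by
  cases r with
  | zero => exact Ideal.pow_right_mono hm _
  | succ r =>
    exact sup_le_sup (Ideal.mul_mono (Ideal.pow_right_mono hn _) (Ideal.pow_right_mono hm _))
      (Ideal.pow_right_mono hm _)

theorem pow_le_nextTerm (𝔫 𝔪 : Ideal S) (q r : ℕ) : 𝔪 ^ (q + r + 1) ≤ nextTerm 𝔫 𝔪 q r := by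
  cases r with
  | zero => exact le_rfl
  | succ r => exact le_sup_right

theorem mul_le_nextTerm (𝔫 𝔪 : Ideal S) (q r : ℕ) :
    𝔫 ^ (q + 1) * 𝔪 ^ r ≤ nextTerm 𝔫 𝔪 q (r + 1) := le_sup_left

theorem nextTerm_le_sup (𝔫 𝔪 : Ideal S) (q r : ℕ) :
    nextTerm 𝔫 𝔪 q r ≤ 𝔫 ^ (q + 1) ⊔ 𝔪 ^ (q + r + 1) := by
  cases r with
  | zero => exact le_sup_right
  | succ r => exact sup_le_sup Ideal.mul_le_left le_rfl

/-- Replacing the factors of a product of `n + 1` elements of `𝔟` by elements that are congruent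
modulo `𝔢` changes it by an element of `𝔢 𝔟 ^ n`. -/
theorem prod_sub_prod_mem {n : ℕ} {𝔟 𝔢 : Ideal S} {x y : Fin (n + 1) → S} (hx : ∀ j, x j ∈ 𝔟)
    (hy : ∀ j, y j ∈ 𝔟) (h : ∀ j, x j - y j ∈ 𝔢) : ∏ j, x j - ∏ j, y j ∈ 𝔢 * 𝔟 ^ n := by
  induction n with
  | zero => simpa using h 0
  | succ n ih =>
    rw [Fin.prod_univ_castSucc, Fin.prod_univ_castSucc (f := y)]
    have h1 : (∏ j : Fin (n + 1), x j.castSucc - ∏ j : Fin (n + 1), y j.castSucc) *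
        x (Fin.last (n + 1)) ∈ 𝔢 * 𝔟 ^ (n + 1) := by
      rw [pow_succ, ← mul_assoc]
      exact Ideal.mul_mem_mul (ih (fun j => hx _) (fun j => hy _) fun j => h _) (hx _)
    have h2 : (x (Fin.last (n + 1)) - y (Fin.last (n + 1))) * ∏ j : Fin (n + 1), y j.castSucc ∈
        𝔢 * 𝔟 ^ (n + 1) := by
      refine Ideal.mul_mem_mul (h _) ?_
      simpa using Ideal.prod_mem_prod (s := Finset.univ) (I := fun _ : Fin (n + 1) => 𝔟)
        (x := fun j => y j.castSucc) fun j _ => hy _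
    convert! Ideal.add_mem _ h1 h2 using 1
    ring

theorem prod_mem_pow {n : ℕ} {𝔟 : Ideal S} {x : Fin n → S} (hx : ∀ j, x j ∈ 𝔟) :
    ∏ j, x j ∈ 𝔟 ^ n := by
  simpa using Ideal.prod_mem_prod (s := Finset.univ) (I := fun _ : Fin n => 𝔟) fun j _ => hx j

/-- The product `x₁ ⋯ x_q y₁ ⋯ y_r z`, with `xⱼ ∈ 𝔫` taken modulo `𝔫 ^ 2`, with `yⱼ ∈ 𝔪` taken
modulo `𝔫` and with `z` taken modulo `𝔪`, is well defined modulo `nextTerm 𝔫 𝔪 q r`. -/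
theorem prod_mul_prod_mul_sub_mem {𝔫 𝔪 : Ideal S} (hnm : 𝔫 ≤ 𝔪) {q r : ℕ} {x x' : Fin q → S}
    {y y' : Fin r → S} {z z' : S} (hx : ∀ j, x j - x' j ∈ 𝔫 ^ 2) (hx' : ∀ j, x' j ∈ 𝔫)
    (hy : ∀ j, y j - y' j ∈ 𝔫) (hy' : ∀ j, y' j ∈ 𝔪) (hz : z - z' ∈ 𝔪) :
    (∏ j, x j) * (∏ j, y j) * z - (∏ j, x' j) * (∏ j, y' j) * z' ∈ nextTerm 𝔫 𝔪 q r := by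
  have hx1 : ∀ j, x j ∈ 𝔫 := fun j => by
    simpa using Ideal.add_mem _ (Ideal.pow_le_self two_ne_zero (hx j)) (hx' j)
  have hy1 : ∀ j, y j ∈ 𝔪 := fun j => by simpa using Ideal.add_mem _ (hnm (hy j)) (hy' j)
  have key : (∏ j, x j) * (∏ j, y j) * z - (∏ j, x' j) * (∏ j, y' j) * z' =
      (∏ j, x j - ∏ j, x' j) * (∏ j, y j) * z + (∏ j, x' j) * (∏ j, y j - ∏ j, y' j) * z +
        (∏ j, x' j) * (∏ j, y' j) * (z - z') := by ring
  rw [key]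
  refine Ideal.add_mem _ (Ideal.add_mem _ ?_ ?_) ?_
  · refine Ideal.mul_mem_right _ _ ?_
    cases q with
    | zero => simp
    | succ n =>
      have h1 := Ideal.mul_mem_mul (prod_sub_prod_mem hx1 hx' hx) (prod_mem_pow hy1)
      refine pow_le_nextTerm 𝔫 𝔪 _ _ ?_
      rw [← pow_add] at h1
      rw [show n + 1 + r + 1 = 2 + n + r by ring, pow_add]
      exact Ideal.mul_mono (Ideal.pow_right_mono hnm _) le_rfl h1
  · refine Ideal.mul_mem_right _ _ ?_
    cases r with
    | zero => simp
    | succ n =>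
      have h1 := Ideal.mul_mem_mul (prod_mem_pow hx') (prod_sub_prod_mem hy1 hy' hy)
      rw [← mul_assoc, ← pow_succ] at h1
      exact mul_le_nextTerm _ _ _ _ h1
  · refine pow_le_nextTerm 𝔫 𝔪 _ _ ?_
    rw [pow_succ, pow_add]
    exact Ideal.mul_mem_mul (Ideal.mul_mem_mul
      (Ideal.pow_right_mono hnm _ (prod_mem_pow hx')) (prod_mem_pow hy')) hz

/-- Pigeonhole for powers of a sum of two ideals. -/
theorem Ideal.sup_pow_succ_le (𝔞 𝔟 : Ideal S) (q r : ℕ) :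
    (𝔞 ⊔ 𝔟) ^ (q + r + 1) ≤ 𝔞 ^ (q + 1) ⊔ 𝔟 ^ (r + 1) := by
  rw [← Ideal.add_eq_sup, add_pow]
  refine Finset.sum_induction _ (· ≤ 𝔞 ^ (q + 1) ⊔ 𝔟 ^ (r + 1))
    (fun a b ha hb => (Ideal.add_eq_sup (I := a) (J := b)).trans_le (sup_le ha hb)) bot_le
    fun i hi => Ideal.mul_le_left.trans ?_
  by_cases h : q + 1 ≤ i
  · exact (Ideal.mul_le_left.trans (Ideal.pow_le_pow_right h)).trans le_sup_left
  · exact (Ideal.mul_le_right.trans (Ideal.pow_le_pow_right (by omega))).trans le_sup_right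

/-- Modulo multiples of `𝔞`, a power of `𝔞 + 𝔟` is the same power of `𝔟`. -/
theorem Ideal.mul_sup_pow_le (𝔞 𝔟 𝔠 : Ideal S) (h : 𝔞 ⊔ 𝔟 ≤ 𝔠) (r : ℕ) :
    (𝔞 ⊔ 𝔟) ^ (r + 1) ≤ 𝔞 * 𝔠 ^ r ⊔ 𝔟 ^ (r + 1) := by
  induction r with
  | zero => simp
  | succ r ih =>
    rw [pow_succ]
    refine (Ideal.mul_mono_left ih).trans ?_
    rw [Ideal.sup_mul]
    refine sup_le ?_ ?_
    · rw [mul_assoc, pow_succ]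
      exact le_sup_of_le_left (Ideal.mul_mono_right (Ideal.mul_mono_right h))
    · rw [Ideal.mul_sup, ← pow_succ]
      refine sup_le_sup ?_ le_rfl
      rw [mul_comm]
      exact Ideal.mul_mono_right (Ideal.pow_right_mono (le_sup_right.trans h) _)

theorem Ideal.span_range_pow {κ : Type*} (g : κ → S) (n : ℕ) :
    Ideal.span (Set.range g) ^ n = Ideal.span (Set.range fun f : Fin n → κ => ∏ j, g (f j)) := by
  induction n with
  | zero => simp
  | succ n ih =>
    rw [pow_succ, ih, Ideal.span_mul_span']
    congr 1
    ext x
    constructor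
    · rintro ⟨_, ⟨f, rfl⟩, _, ⟨k, rfl⟩, rfl⟩
      refine ⟨Fin.snoc f k, ?_⟩
      simp [Fin.prod_univ_castSucc]
    · rintro ⟨f, rfl⟩
      exact ⟨_, ⟨fun j => f j.castSucc, rfl⟩, _, ⟨f (Fin.last n), rfl⟩,
        (Fin.prod_univ_castSucc fun j => g (f j)).symm⟩

end Ideals

namespace BundleChart

open SymmetricAlgebra

variable {X : BundleChart}

section Generators

variable (X) in
/-- The ideal of `Sym W` generated by the kernel of `ε : W → L`. -/
def kerIdeal : Ideal X.SymW := Ideal.span (Set.range fun w : LinearMap.ker X.ε => ι X.A X.W w)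

theorem kerIdeal_le_I : X.kerIdeal ≤ X.I := by
  rw [kerIdeal, Ideal.span_le]
  rintro _ ⟨w, rfl⟩
  change symMap X.φ X.ε _ = 0
  rw [symMap_ι, show X.ε w = 0 from w.2, map_zero]

/-- The kernel of `Sym W → Sym L` is generated by the kernels of `A → B` and of `W → L`. -/
theorem I_eq_sup (hφ : Function.Surjective X.φ) (hε : Function.Surjective X.ε) :
    X.I = X.J ⊔ X.kerIdeal := by
  refine le_antisymm ?_ (sup_le J_le_I kerIdeal_le_I)
  choose sA hsA using hφ
  choose sW hsW using hε
  set 𝔟 := X.J ⊔ X.kerIdeal with h𝔟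
  let C := X.SymW ⧸ 𝔟
  let mk : X.SymW →+* C := Ideal.Quotient.mk 𝔟
  have hA : ∀ a a' : X.A, X.φ a = X.φ a' → mk (algebraMap _ _ a) = mk (algebraMap _ _ a') := by
    intro a a' h
    rw [Ideal.Quotient.eq, ← map_sub]
    refine Ideal.mem_sup_left (Ideal.mem_map_of_mem _ ?_)
    change X.φ (a - a') = 0
    rw [map_sub, h, sub_self]
  have hW : ∀ w w' : X.W, X.ε w = X.ε w' → mk (ι _ _ w) = mk (ι _ _ w') := by
    intro w w' h
    rw [Ideal.Quotient.eq, ← map_sub]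
    refine Ideal.mem_sup_right (Ideal.subset_span ⟨⟨w - w', ?_⟩, rfl⟩)
    change X.ε (w - w') = 0
    rw [map_sub, h, sub_self]
  -- an inverse `Sym L → Sym W / 𝔟` of the induced map
  let b : X.B →+* C :=
    { toFun := fun y => mk (algebraMap _ _ (sA y))
      map_zero' := by
        rw [hA _ 0 (by rw [hsA, map_zero]), map_zero, map_zero]
      map_one' := by
        rw [hA _ 1 (by rw [hsA, map_one]), map_one, map_one]
      map_add' := fun y z => by
        rw [← map_add, ← map_add]
        exact hA _ _ (by simp only [map_add, hsA])
      map_mul' := fun y z => by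
        rw [← map_mul, ← map_mul]
        exact hA _ _ (by simp only [map_mul, hsA]) }
  let _ : Algebra X.B C := b.toAlgebra
  let l : X.L →ₗ[X.B] C :=
    { toFun := fun y => mk (ι _ _ (sW y))
      map_add' := fun y z => by
        rw [← map_add, ← map_add]
        exact hW _ _ (by simp only [map_add, hsW])
      map_smul' := fun c y => by
        rw [RingHom.id_apply, Algebra.smul_def]
        change _ = mk (algebraMap _ _ (sA c)) * _
        rw [← map_mul, ← Algebra.smul_def, ← map_smul]
        exact hW _ _ (by simp only [LinearMap.map_smulₛₗ, hsA, hsW]) }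
  have key : ∀ s : X.SymW, SymmetricAlgebra.lift l (X.symε s) = mk s := by
    intro s
    induction s using SymmetricAlgebra.induction with
    | algebraMap a =>
      rw [symε, symMap_algebraMap, AlgHom.commutes]
      exact hA _ _ (by simp only [hsA])
    | ι w =>
      rw [symε, symMap_ι, lift_ι_apply]
      exact hW _ _ (by simp only [hsW])
    | mul a b ha hb => rw [map_mul, map_mul, map_mul, ha, hb]
    | add a b ha hb => rw [map_add, map_add, map_add, ha, hb]
  intro s hs
  rw [← Ideal.Quotient.eq_zero_iff_mem]
  change mk s = 0
  rw [← key, show X.symε s = 0 from hs, map_zero]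

/-- The elements of `J ^ q I ^ r` are sums of products `a₁ ⋯ a_q w₁ ⋯ w_r s` and of elements of
`nextTerm J I q r`. -/
theorem mul_induction (hφ : Function.Surjective X.φ) (hε : Function.Surjective X.ε) {q r : ℕ}
    {motive : X.SymW → Prop} (add : ∀ x y, motive x → motive y → motive (x + y))
    (next : ∀ x ∈ nextTerm X.J X.I q r, motive x)
    (gen : ∀ (a : Fin q → X.ID) (w : Fin r → LinearMap.ker X.ε) (s : X.SymW),
      motive ((∏ j, algebraMap X.A X.SymW (a j)) * (∏ j, ι X.A X.W (w j)) * s)) :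
    ∀ x ∈ X.J ^ q * X.I ^ r, motive x := by
  have h1 : X.J ^ q * X.I ^ r ≤ nextTerm X.J X.I q r ⊔ X.J ^ q * X.kerIdeal ^ r := by
    cases r with
    | zero => simp
    | succ r =>
      have := Ideal.mul_sup_pow_le X.J X.kerIdeal X.I (I_eq_sup hφ hε).ge r
      rw [← I_eq_sup hφ hε] at this
      refine (Ideal.mul_mono_right this).trans ?_
      rw [Ideal.mul_sup, ← mul_assoc, ← pow_succ]
      exact sup_le_sup (mul_le_nextTerm _ _ _ _) le_rfl
  intro x hx
  obtain ⟨y, hy, z, hz, rfl⟩ := Submodule.mem_sup.mp (h1 hx)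
  refine add _ _ (next y hy) ?_
  have hJ : X.J = Ideal.span (Set.range fun a : X.ID => algebraMap X.A X.SymW a) := by
    rw [J, Ideal.map, Set.image_eq_range]
    rfl
  rw [hJ, kerIdeal, Ideal.span_range_pow, Ideal.span_range_pow, Ideal.span_mul_span'] at hz
  have hz' : ∀ s, motive (z * s) := by
    refine Submodule.span_induction (p := fun z _ => ∀ s, motive (z * s)) ?_ ?_ ?_ ?_ hz
    · rintro _ ⟨_, ⟨a, rfl⟩, _, ⟨w, rfl⟩, rfl⟩ s
      exact gen a w s
    · intro s
      rw [zero_mul]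
      exact next 0 (Ideal.zero_mem _)
    · intro y z _ _ hy hz s
      rw [add_mul]
      exact add _ _ (hy s) (hz s)
    · intro t z _ hz s
      rw [smul_eq_mul, mul_comm t, mul_assoc]
      exact hz (t * s)
  simpa using hz' 1

end Generators

end BundleChart

theorem SymmetricAlgebra.component_mul_of_mem {R M : Type} [CommRing R] [AddCommGroup M]
    [Module R M] {m : ℕ} {x : SymmetricAlgebra R M} (hx : x ∈ symPow R M m) (d : ℕ)
    (y : SymmetricAlgebra R M) :
    SymmetricAlgebra.component (d + m) (x * y) = x * SymmetricAlgebra.component d y := by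
  rw [component_apply, map_mul, coaction_of_mem_symPow hx, Polynomial.coeff_monomial_mul,
    component_apply]

namespace BundleChart

open SymmetricAlgebra

variable {X : BundleChart}

/-! ### Generators -/

theorem toN_surjective (hφ : Function.Surjective X.φ) :
    Function.Surjective (toN : X.ID → X.N) := by
  intro x
  induction x using TensorProduct.induction_on with
  | zero => exact ⟨0, by rw [toN, map_zero, TensorProduct.tmul_zero]⟩
  | tmul b c =>
    obtain ⟨a, rfl⟩ := hφ b
    obtain ⟨y, rfl⟩ := X.ID.toCotangent_surjective c
    refine ⟨a • y, ?_⟩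
    rw [toN, map_smul, ← TensorProduct.smul_tmul]
    congr 1
    exact mul_one (X.φ a)
  | add x y hx hy =>
    obtain ⟨a, rfl⟩ := hx
    obtain ⟨b, rfl⟩ := hy
    exact ⟨a + b, by rw [toN, toN, toN, map_add, TensorProduct.tmul_add]⟩

theorem one_tmul_surjective (hφ : Function.Surjective X.φ) (x : X.WD) :
    ∃ w : X.W, (1 : X.B) ⊗ₜ[X.A] w = x := by
  induction x using TensorProduct.induction_on with
  | zero => exact ⟨0, by rw [TensorProduct.tmul_zero]⟩
  | tmul b c =>
    obtain ⟨a, rfl⟩ := hφ b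
    refine ⟨a • c, ?_⟩
    rw [← TensorProduct.smul_tmul]
    congr 1
    exact mul_one (X.φ a)
  | add x y hx hy =>
    obtain ⟨a, rfl⟩ := hx
    obtain ⟨b, rfl⟩ := hy
    exact ⟨a + b, by rw [TensorProduct.tmul_add]⟩

theorem εD_one_tmul (w : X.W) : X.εD ((1 : X.B) ⊗ₜ[X.A] w) = X.ε w := by
  change X.εA.liftBaseChange X.B _ = _
  rw [LinearMap.liftBaseChange_tmul, one_smul]
  rfl

theorem toK_surjective (hφ : Function.Surjective X.φ) :
    Function.Surjective (toK : LinearMap.ker X.ε → X.K) := by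
  rintro ⟨x, hx⟩
  obtain ⟨w, rfl⟩ := one_tmul_surjective hφ x
  have hx' : X.εD _ = 0 := hx
  rw [εD_one_tmul] at hx'
  exact ⟨⟨w, hx'⟩, rfl⟩

theorem symε_surjective (hφ : Function.Surjective X.φ) (hε : Function.Surjective X.ε) :
    Function.Surjective X.symε := symMap_surjective X.φ X.ε hφ hε

/-- The element of `Sym L ⊗ (S^q N ⊗ S^{p-q} K)` corresponding to `a₁ ⋯ a_q w₁ ⋯ w_{p-q} s`. -/
def tGenerator {p q : ℕ} (a : Fin q → X.ID) (w : Fin (p - q) → LinearMap.ker X.ε) (s : X.SymW) :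
    X.T p q :=
  X.symε s ⊗ₜ[X.B] (symProd (fun j => toN (a j)) ⊗ₜ[X.B] symProd (fun j => toK (w j)))

theorem smul_tGenerator {p q : ℕ} (a : Fin q → X.ID) (w : Fin (p - q) → LinearMap.ker X.ε)
    (s t : X.SymW) : X.symε t • tGenerator a w s = tGenerator a w (t * s) := by
  rw [tGenerator, tGenerator, TensorProduct.smul_tmul', map_mul, smul_eq_mul]

/-- `Sym L ⊗ (S^q N ⊗ S^{p-q} K)` is generated additively by the images of the generators `a₁ ⋯
a_q w₁ ⋯ w_{p-q} s`; no scalars are needed, as `s` absorbs them. -/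
theorem T_induction (hφ : Function.Surjective X.φ) (hε : Function.Surjective X.ε) {p q : ℕ}
    {motive : X.T p q → Prop} (add : ∀ x y, motive x → motive y → motive (x + y))
    (gen : ∀ (a : Fin q → X.ID) (w : Fin (p - q) → LinearMap.ker X.ε) (s : X.SymW),
      motive (tGenerator a w s)) (x : X.T p q) : motive x := by
  have zero : motive 0 := by
    have h := gen (fun _ => 0) (fun _ => 0) 0
    rwa [tGenerator, map_zero, TensorProduct.zero_tmul] at h
  have h1 : ∀ (a : Fin q → X.ID) (k : symPow X.B X.K (p - q)) (s : X.SymW),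
      motive (X.symε s ⊗ₜ[X.B] (symProd (fun j => toN (a j)) ⊗ₜ[X.B] k)) := by
    intro a k
    have hk : k ∈ Submodule.span X.B (Set.range (symProd : (Fin (p - q) → X.K) → _)) :=
      span_symProd (R := X.B) (M := X.K) (p - q) ▸ Submodule.mem_top
    refine Submodule.span_induction (p := fun k _ => ∀ s : X.SymW,
      motive (X.symε s ⊗ₜ[X.B] (symProd (fun j => toN (a j)) ⊗ₜ[X.B] k))) ?_ ?_ ?_ ?_ hk
    · rintro _ ⟨m, rfl⟩ s
      choose w hw using fun j => toK_surjective hφ (m j)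
      obtain rfl : (fun j => toK (w j)) = m := funext hw
      exact gen a w s
    · intro s
      rw [TensorProduct.tmul_zero, TensorProduct.tmul_zero]
      exact zero
    · intro y z _ _ hy hz s
      rw [TensorProduct.tmul_add, TensorProduct.tmul_add]
      exact add _ _ (hy s) (hz s)
    · intro b z _ hz s
      obtain ⟨t, ht⟩ := symε_surjective hφ hε (b • X.symε s)
      rw [TensorProduct.tmul_smul, TensorProduct.tmul_smul, TensorProduct.smul_tmul', ← ht]
      exact hz t
  have h2 : ∀ (n : symPow X.B X.N q) (k : symPow X.B X.K (p - q)) (s : X.SymW),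
      motive (X.symε s ⊗ₜ[X.B] (n ⊗ₜ[X.B] k)) := by
    intro n k
    have hn : n ∈ Submodule.span X.B (Set.range (symProd : (Fin q → X.N) → _)) :=
      span_symProd (R := X.B) (M := X.N) q ▸ Submodule.mem_top
    refine Submodule.span_induction (p := fun n _ => ∀ s : X.SymW,
      motive (X.symε s ⊗ₜ[X.B] (n ⊗ₜ[X.B] k))) ?_ ?_ ?_ ?_ hn
    · rintro _ ⟨m, rfl⟩ s
      choose a ha using fun j => toN_surjective hφ (m j)
      obtain rfl : (fun j => toN (a j)) = m := funext ha
      exact h1 a k s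
    · intro s
      rw [TensorProduct.zero_tmul, TensorProduct.tmul_zero]
      exact zero
    · intro y z _ _ hy hz s
      rw [TensorProduct.add_tmul, TensorProduct.tmul_add]
      exact add _ _ (hy s) (hz s)
    · intro b z _ hz s
      obtain ⟨t, ht⟩ := symε_surjective hφ hε (b • X.symε s)
      rw [← TensorProduct.smul_tmul', TensorProduct.tmul_smul, TensorProduct.smul_tmul', ← ht]
      exact hz t
  induction x using TensorProduct.induction_on with
  | zero => exact zero
  | add x y hx hy => exact add x y hx hy
  | tmul l y =>
    obtain ⟨s, rfl⟩ := symε_surjective hφ hε l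
    induction y using TensorProduct.induction_on with
    | zero => rw [TensorProduct.tmul_zero]; exact zero
    | tmul n k => exact h2 n k s
    | add y z hy hz => rw [TensorProduct.tmul_add]; exact add _ _ hy hz

/-! ### The filtration -/

/-- The terms of the filtration, described by representatives in `Sym W`. -/
theorem mk_mem_F {p q : ℕ} (h : q ≤ p) (x : ↥(X.I ^ p)) :
    (Submodule.Quotient.mk x : X.Q p) ∈ X.F p q ↔
      (x : X.SymW) ∈ X.J ^ q * X.I ^ (p - q) ⊔ X.I ^ (p + 1) := by
  rw [F, if_pos h]
  constructor
  · rintro ⟨y, hy, hyx⟩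
    have h1 : (y : X.SymW) - x ∈ X.I ^ (p + 1) :=
      (Submodule.Quotient.eq ((X.I ^ (p + 1)).submoduleOf (X.I ^ p))).mp hyx
    rw [← sub_sub_self (y : X.SymW) x]
    exact Ideal.sub_mem _ (Ideal.mem_sup_left hy) (Ideal.mem_sup_right h1)
  · intro hx
    obtain ⟨y, hy, z, hz, hyz⟩ := Submodule.mem_sup.mp hx
    refine ⟨⟨y, J_pow_mul_le h hy⟩, hy, (Submodule.Quotient.eq _).mpr ?_⟩
    change y - (x : X.SymW) ∈ X.I ^ (p + 1)
    rw [← hyz, sub_add_cancel_left]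
    exact neg_mem hz

theorem mk_mem_F_of_lt {p q : ℕ} (h : p < q) (x : ↥(X.I ^ p)) :
    (Submodule.Quotient.mk x : X.Q p) ∈ X.F p q ↔ (x : X.SymW) ∈ X.I ^ (p + 1) := by
  rw [F, if_neg h.not_ge, Submodule.mem_bot, Submodule.Quotient.mk_eq_zero]
  rfl

theorem F_zero (p : ℕ) : X.F p 0 = ⊤ := by
  rw [eq_top_iff]
  intro x _
  obtain ⟨x, rfl⟩ := Submodule.Quotient.mk_surjective _ x
  rw [mk_mem_F (Nat.zero_le p)]
  exact Ideal.mem_sup_left (by simp)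

theorem F_eq_bot {p q : ℕ} (h : p < q) : X.F p q = ⊥ := by rw [F, if_neg h.not_ge]

theorem F_antitone (p : ℕ) : Antitone (X.F p) := by
  refine antitone_nat_of_succ_le fun q => ?_
  by_cases h : q + 1 ≤ p
  · intro x hx
    obtain ⟨x, rfl⟩ := Submodule.Quotient.mk_surjective _ x
    rw [mk_mem_F h] at hx
    rw [mk_mem_F (Nat.le_of_succ_le h)]
    refine (sup_le_sup ?_ le_rfl : X.J ^ (q + 1) * X.I ^ (p - (q + 1)) ⊔ X.I ^ (p + 1) ≤ _) hx
    rw [pow_succ, mul_assoc]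
    refine Ideal.mul_mono_right ((Ideal.mul_mono_left J_le_I).trans_eq ?_)
    rw [← pow_succ']
    congr 1
    omega
  · rw [F_eq_bot (not_le.mp h)]
    exact bot_le

theorem isHomogeneous_I : IsHomogeneous X.I := isHomogeneous_ker_symMap X.φ X.ε

theorem isHomogeneous_J : IsHomogeneous X.J := isHomogeneous_map_algebraMap X.ID

theorem isHomogeneous_nextTerm (q r : ℕ) : IsHomogeneous (nextTerm X.J X.I q r) := by
  cases r with
  | zero => exact isHomogeneous_I.pow _
  | succ r =>
    exact ((isHomogeneous_J.pow _).mul (isHomogeneous_I.pow _)).sup (isHomogeneous_I.pow _)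

/-- The terms of the filtration are graded: they are generated by their homogeneous elements. -/
theorem F_graded (p q : ℕ) (x : X.Q p) (hx : x ∈ X.F p q) :
    x ∈ AddSubgroup.closure {y | y ∈ X.F p q ∧ ∃ d, y ∈ X.QDeg p d} := by
  by_cases h : q ≤ p
  · rw [F, if_pos h] at hx
    obtain ⟨y, hy, rfl⟩ := hx
    have hy' : (y : X.SymW) ∈ X.J ^ q * X.I ^ (p - q) := hy
    have hd : ∀ d, component d (y : X.SymW) ∈ X.J ^ q * X.I ^ (p - q) :=
      ((isHomogeneous_J.pow q).mul (isHomogeneous_I.pow (p - q))) _ hy'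
    have hsum : y = ∑ d ∈ (coaction X.A X.W (y : X.SymW)).support,
        (⟨component d (y : X.SymW), J_pow_mul_le h (hd d)⟩ : ↥(X.I ^ p)) := by
      refine Subtype.ext ?_
      rw [AddSubmonoidClass.coe_finsetSum]
      exact (sum_component (y : X.SymW)).symm
    rw [hsum, map_sum]
    refine AddSubgroup.sum_mem _ fun d _ => AddSubgroup.subset_closure ⟨?_, d, ?_⟩
    · exact (mk_mem_F h _).mpr (Ideal.mem_sup_left (hd d))
    · exact ⟨_, component_mem d _, rfl⟩
  · rw [F, if_neg h, Submodule.mem_bot] at hx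
    rw [hx]
    exact AddSubgroup.zero_mem _

theorem subsingleton_Gr {p q : ℕ} (h : p < q) : Subsingleton (X.Gr p q) := by
  have hF : Subsingleton (X.F p q) := by
    rw [F_eq_bot h]
    infer_instance
  exact (Submodule.Quotient.mk_surjective _).subsingleton

section grClass

variable {p q : ℕ} (h : q ≤ p)

theorem grClass_surjective (y : X.Gr p q) : ∃ x hx, grClass h x hx = y := by
  obtain ⟨⟨y, hy⟩, rfl⟩ := Submodule.Quotient.mk_surjective _ y
  have hy' := hy
  rw [F, if_pos h] at hy'
  obtain ⟨x, hx, rfl⟩ := hy'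
  exact ⟨x, hx, rfl⟩

theorem grClass_add {x y : X.SymW} (hx hy) :
    grClass h (x + y) (Ideal.add_mem _ hx hy) = grClass h x hx + grClass h y hy := rfl

theorem smul_grClass (s : X.SymW) {x : X.SymW} (hx) :
    s • grClass h x hx = grClass h (s * x) (Ideal.mul_mem_left _ s hx) := rfl

theorem grClass_congr {x y : X.SymW} {hx} (e : x = y) {hy} :
    grClass h x hx = grClass h y hy := by
  subst e
  rfl

/-- The kernel of `J ^ q I ^ (p - q) → gr_q` is its intersection with `nextTerm J I q (p - q)`;
for `q = p` this is the intersection with `I ^ (p + 1)`, as `F^{p+1} = 0`. -/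
theorem grClass_eq_zero_iff {x : X.SymW} (hx) :
    grClass h x hx = 0 ↔ x ∈ nextTerm X.J X.I q (p - q) := by
  rw [grClass, Submodule.Quotient.mk_eq_zero]
  change (Submodule.Quotient.mk (⟨x, _⟩ : ↥(X.I ^ p)) : X.Q p) ∈ X.F p (q + 1) ↔ _
  rcases h.eq_or_lt with rfl | h'
  · rw [mk_mem_F_of_lt (Nat.lt_succ_self _), Nat.sub_self]
    rfl
  · rw [mk_mem_F h']
    obtain ⟨r, hr⟩ : ∃ r, p - q = r + 1 := ⟨p - q - 1, by omega⟩
    rw [hr, show p - (q + 1) = r by omega, nextTerm, show q + r + 2 = p + 1 by omega]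

theorem grClass_mem_GrDeg {d : ℕ} {x : X.SymW} (hx) (hd : x ∈ symPow X.A X.W d) :
    grClass h x hx ∈ X.GrDeg p q d :=
  ⟨⟨Submodule.Quotient.mk ⟨x, J_pow_mul_le h hx⟩, by
    rw [mk_mem_F h]
    exact Ideal.mem_sup_left hx⟩, ⟨⟨x, J_pow_mul_le h hx⟩, hd, rfl⟩, rfl⟩

theorem grClass_eq_iff {x y : X.SymW} (hx) (hy) :
    grClass h x hx = grClass h y hy ↔ x - y ∈ nextTerm X.J X.I q (p - q) := by
  rw [← grClass_eq_zero_iff h (Ideal.sub_mem _ hx hy), ← sub_eq_zero]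
  rfl

variable (X) in
/-- The map `J ^ q I ^ (p - q) → gr_q (I ^ p / I ^ (p + 1))`. -/
def grHom : ↥(X.J ^ q * X.I ^ (p - q)) →ₗ[X.SymW] X.Gr p q where
  toFun x := grClass h x x.2
  map_add' _ _ := rfl
  map_smul' _ _ := rfl

end grClass

/-! ### Consequences of the description by generators -/

section Iso

variable {p q : ℕ} (hq : q ≤ p) (Φ : X.T p q ≃+ X.Gr p q)

/-- An additive isomorphism with the expected values on generators is linear over `Sym W`. -/
theorem iso_smul (hφ : Function.Surjective X.φ) (hε : Function.Surjective X.ε)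
    (hΦ : ∀ a w s, Φ (tGenerator a w s) = grGenerator hq a w s) (s : X.SymW) (x : X.T p q) :
    Φ (X.symε s • x) = s • Φ x := by
  induction x using T_induction hφ hε with
  | add x y hx hy => rw [smul_add, map_add, hx, hy, map_add, smul_add]
  | gen a w t =>
    rw [smul_tGenerator, hΦ, hΦ, grGenerator, grGenerator, smul_grClass]
    congr 1
    ring

/-- The projection of `Sym L ⊗ (S^q N ⊗ S^{p-q} K)` to the part with components of degree `e` in
`Sym L`. -/
def tComponent (p q e : ℕ) : X.T p q →ₗ[X.B] X.T p q :=
  (component (R := X.B) (M := X.L) e).rTensor _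

theorem tComponent_mem (e : ℕ) (x : X.T p q) : tComponent p q e x ∈ X.TDeg p q (e + (p - q)) := by
  induction x using TensorProduct.induction_on with
  | zero => rw [map_zero]; exact AddSubgroup.zero_mem _
  | add x y hx hy => rw [map_add]; exact AddSubgroup.add_mem _ hx hy
  | tmul l y =>
    exact AddSubgroup.subset_closure ⟨e, rfl, component e l, component_mem e l, y,
      LinearMap.rTensor_tmul _ _ _ _⟩

theorem exists_sum_tComponent (x : X.T p q) :
    ∃ n, ∀ m ≥ n, ∑ e ∈ Finset.range m, tComponent p q e x = x := by
  induction x using TensorProduct.induction_on with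
  | zero => exact ⟨0, fun m _ => by simp⟩
  | add x y hx hy =>
    obtain ⟨n, hn⟩ := hx
    obtain ⟨n', hn'⟩ := hy
    refine ⟨max n n', fun m hm => ?_⟩
    simp only [map_add, Finset.sum_add_distrib]
    rw [hn m (le_of_max_le_left hm), hn' m (le_of_max_le_right hm)]
  | tmul l y =>
    refine ⟨(coaction X.B X.L l).natDegree + 1, fun m hm => ?_⟩
    have h1 : ∑ e ∈ Finset.range m, component e l = l := by
      conv_rhs => rw [← sum_component l]
      symm
      refine Finset.sum_subset (fun d hd => Finset.mem_range.mpr ?_) (fun d _ hd => ?_)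
      · exact lt_of_lt_of_le (Nat.lt_succ_of_le (Polynomial.le_natDegree_of_mem_supp d hd)) hm
      · exact Polynomial.notMem_support_iff.mp hd
    simp only [tComponent, LinearMap.rTensor_tmul]
    rw [← TensorProduct.sum_tmul, h1]

theorem tComponent_tGenerator (a : Fin q → X.ID) (w : Fin (p - q) → LinearMap.ker X.ε)
    (s : X.SymW) (e : ℕ) :
    tComponent p q e (tGenerator a w s) = tGenerator a w (component e s) := by
  rw [tComponent, tGenerator, tGenerator, LinearMap.rTensor_tmul, symε, component_symMap]

theorem prod_mem_symPow (a : Fin q → X.ID) (w : Fin (p - q) → LinearMap.ker X.ε) :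
    (∏ j, algebraMap X.A X.SymW (a j)) * (∏ j, ι X.A X.W (w j)) ∈ symPow X.A X.W (p - q) := by
  rw [← map_prod, ← Algebra.smul_def]
  exact Submodule.smul_mem _ _ (symProd fun j => (w j : X.W)).2

/-- An isomorphism with the expected values on generators transforms the projections to the
homogeneous components of the source into those of `Sym W`, with degrees shifted by `p - q`. -/
theorem iso_tComponent (hφ : Function.Surjective X.φ) (hε : Function.Surjective X.ε)
    (hΦ : ∀ a w s, Φ (tGenerator a w s) = grGenerator hq a w s) (x : X.T p q) (e : ℕ) (u : X.SymW)
    (hu : u ∈ X.J ^ q * X.I ^ (p - q)) (h : Φ x = grClass hq u hu) :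
    Φ (tComponent p q e x) = grClass hq (component (e + (p - q)) u)
      (((isHomogeneous_J.pow q).mul (isHomogeneous_I.pow (p - q))) u hu _) := by
  have key : ∃ v hv, Φ x = grClass hq v hv ∧
      ∀ hv', Φ (tComponent p q e x) = grClass hq (component (e + (p - q)) v) hv' := by
    clear h
    induction x using T_induction hφ hε with
    | add x y hx hy =>
      obtain ⟨v, hv, h1, h2⟩ := hx
      obtain ⟨v', hv', h1', h2'⟩ := hy
      have hom := (isHomogeneous_J (X := X).pow q).mul (isHomogeneous_I.pow (p - q))
      refine ⟨v + v', Ideal.add_mem _ hv hv', ?_, fun _ => ?_⟩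
      · rw [map_add, h1, h1', grClass_add]
      · rw [map_add, map_add, h2 (hom v hv _), h2' (hom v' hv' _), ← grClass_add]
        exact grClass_congr hq (map_add _ _ _).symm
    | gen a w s =>
      refine ⟨_, generator_mem a w s, hΦ a w s, fun _ => ?_⟩
      rw [tComponent_tGenerator, hΦ]
      exact grClass_congr hq (component_mul_of_mem (prod_mem_symPow a w) e s).symm
  obtain ⟨v, hv, h1, h2⟩ := key
  rw [h2 (((isHomogeneous_J.pow q).mul (isHomogeneous_I.pow (p - q))) v hv _), grClass_eq_iff,
    ← map_sub]
  refine isHomogeneous_nextTerm q (p - q) _ ?_ _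
  rw [← grClass_eq_iff hq hv hu, ← h1, h]

/-- An isomorphism with the expected values on generators identifies the gradings. -/
theorem iso_mem_GrDeg (hφ : Function.Surjective X.φ) (hε : Function.Surjective X.ε)
    (hΦ : ∀ a w s, Φ (tGenerator a w s) = grGenerator hq a w s) (d : ℕ) (x : X.T p q) :
    x ∈ X.TDeg p q d ↔ Φ x ∈ X.GrDeg p q d := by
  constructor
  · intro hx
    have hle : X.TDeg p q d ≤ (X.GrDeg p q d).comap (Φ : X.T p q →+ X.Gr p q) := by
      rw [TDeg, AddSubgroup.closure_le]
      rintro _ ⟨e, rfl, t, ht, y, rfl⟩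
      obtain ⟨u, hu, hut⟩ := grClass_surjective hq (Φ (t ⊗ₜ[X.B] y))
      have h1 := iso_tComponent hq Φ hφ hε hΦ _ e u hu hut.symm
      rw [tComponent, LinearMap.rTensor_tmul, component_of_mem ht] at h1
      change Φ (t ⊗ₜ[X.B] y) ∈ X.GrDeg p q (e + (p - q))
      rw [h1]
      exact grClass_mem_GrDeg hq _ (component_mem _ u)
    exact hle hx
  · rintro ⟨⟨_, hF⟩, ⟨u, hu, rfl⟩, hux⟩
    rw [mk_mem_F hq] at hF
    obtain ⟨v, hv, z, hz, hvz⟩ := Submodule.mem_sup.mp hF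
    -- the component of degree `d` of `v` represents the same class
    have hom := (isHomogeneous_J (X := X).pow q).mul (isHomogeneous_I.pow (p - q))
    have hx : Φ x = grClass hq (component d v) (hom v hv d) := by
      rw [← hux]
      refine congrArg Submodule.Quotient.mk (Subtype.ext ((Submodule.Quotient.eq _).mpr ?_))
      have h1 := congrArg (component d) hvz
      rw [map_add, component_of_mem hu] at h1
      change (u : X.SymW) - component d v ∈ X.I ^ (p + 1)
      rw [← h1, add_sub_cancel_left]
      exact isHomogeneous_I.pow _ z hz d
    have h0 : ∀ e, e + (p - q) ≠ d → tComponent p q e x = 0 := by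
      intro e he
      have h1 := iso_tComponent hq Φ hφ hε hΦ x e _ _ hx
      rw [← map_eq_zero_iff Φ Φ.injective, h1, grClass_eq_zero_iff,
        component_of_mem_of_ne he.symm (component_mem d v)]
      exact Ideal.zero_mem _
    obtain ⟨n, hn⟩ := exists_sum_tComponent x
    rw [← hn n le_rfl]
    refine AddSubgroup.sum_mem _ fun e _ => ?_
    by_cases he : e + (p - q) = d
    · exact he ▸ tComponent_mem e x
    · rw [h0 e he]
      exact AddSubgroup.zero_mem _

end Iso

theorem _root_.symPowMap_symProd {R S M N : Type} [CommRing R] [CommRing S] [AddCommGroup M]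
    [Module R M] [AddCommGroup N] [Module S N] (σ : R →+* S) (f : M →ₛₗ[σ] N) {n : ℕ}
    (m : Fin n → M) : symPowMap σ f n (symProd m) = symProd fun j => f (m j) := by
  refine Subtype.ext ?_
  change symMap σ f (∏ j, ι R M (m j)) = ∏ j, ι S N (f (m j))
  rw [map_prod]
  exact Finset.prod_congr rfl fun j _ => symMap_ι σ f (m j)

namespace Hom

variable {Y : BundleChart} (f : Hom X Y)

/-- The restriction map of `I_D`. -/
def resID (a : X.ID) : Y.ID := ⟨f.fA a, f.ID_le a.2⟩

/-- The restriction map of the kernel of `W → L`. -/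
def resKer (w : LinearMap.ker X.ε) : LinearMap.ker Y.ε :=
  ⟨f.fW w, by
    have h : X.ε (w : X.W) = 0 := w.2
    change Y.ε (f.fW w) = 0
    rw [f.comm_ε, h, map_zero]⟩

theorem resN_toN (a : X.ID) : f.resN (toN a) = toN (f.resID a) := by
  change f.fBA 1 ⊗ₜ[Y.A] f.resCotangent (X.ID.toCotangent a) = 1 ⊗ₜ[Y.A] _
  congr 1
  exact map_one f.fB

theorem resK_toK (w : LinearMap.ker X.ε) : f.resK (toK w) = toK (f.resKer w) := by
  refine Subtype.ext ?_
  change f.fBA 1 ⊗ₜ[Y.A] f.fW w = 1 ⊗ₜ[Y.A] f.fW w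
  congr 1
  exact map_one f.fB

theorem resT_tGenerator {p q : ℕ} (a : Fin q → X.ID) (w : Fin (p - q) → LinearMap.ker X.ε)
    (s : X.SymW) : f.resT p q (tGenerator a w s) =
      tGenerator (fun j => f.resID (a j)) (fun j => f.resKer (w j)) (f.symW s) := by
  rw [tGenerator, tGenerator, symε_symW]
  change f.symL (X.symε s) ⊗ₜ[Y.B] (symPowMap f.fB f.resN q _ ⊗ₜ[Y.B]
    symPowMap (M := X.K) (N := Y.K) f.fB f.resK (p - q) _) = _
  rw [symPowMap_symProd, symPowMap_symProd]
  simp only [resN_toN, resK_toK]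

theorem resGr_grGenerator {p q : ℕ} (hq : q ≤ p) (a : Fin q → X.ID)
    (w : Fin (p - q) → LinearMap.ker X.ε) (s : X.SymW) :
    f.resGr p q (grGenerator hq a w s) =
      grGenerator hq (fun j => f.resID (a j)) (fun j => f.resKer (w j)) (f.symW s) := by
  refine (grClass_congr hq (hx := f.symW_mem_J_pow_mul (generator_mem a w s)) ?_ :
    grClass hq (f.symW _) _ = _)
  rw [map_mul, map_mul, map_prod, map_prod]
  congr 2
  · exact Finset.prod_congr rfl fun j _ => symMap_algebraMap f.fA f.fW _
  · exact Finset.prod_congr rfl fun j _ => symMap_ι f.fA f.fW _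

/-- Isomorphisms that have the expected values on the generators are compatible with restriction. -/
theorem iso_resT {p q : ℕ} (hq : q ≤ p) (hφ : Function.Surjective X.φ)
    (hε : Function.Surjective X.ε) (Φ : X.T p q ≃+ X.Gr p q) (Ψ : Y.T p q ≃+ Y.Gr p q)
    (hΦ : ∀ a w s, Φ (tGenerator a w s) = grGenerator hq a w s)
    (hΨ : ∀ a w s, Ψ (tGenerator a w s) = grGenerator hq a w s) (x : X.T p q) :
    Ψ (f.resT p q x) = f.resGr p q (Φ x) := by
  induction x using T_induction hφ hε with
  | add x y hx hy => rw [map_add, map_add, hx, hy, map_add, map_add]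
  | gen a w s => rw [resT_tGenerator, hΦ, hΨ, resGr_grGenerator]

end Hom

end BundleChart

/-! ### Lifting along formally smooth algebras and projective modules -/

/-- Two surjections with the same kernel have isomorphic targets. -/
theorem exists_addEquiv_of_ker_eq {P T G : Type*} [AddCommGroup P] [AddCommGroup T]
    [AddCommGroup G] (g : P →+ T) (γ : P →+ G) (hg : Function.Surjective g)
    (hγ : Function.Surjective γ) (h : ∀ x, g x = 0 ↔ γ x = 0) :
    ∃ Φ : T ≃+ G, ∀ x, Φ (g x) = γ x := by
  have hker : g.ker = γ.ker := AddSubgroup.ext h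
  let e₁ := QuotientAddGroup.quotientKerEquivOfSurjective g hg
  let e₂ := QuotientAddGroup.quotientKerEquivOfSurjective γ hγ
  refine ⟨e₁.symm.trans ((QuotientAddGroup.quotientAddEquivOfEq hker).trans e₂), fun x => ?_⟩
  have h1 : g x = e₁ (QuotientAddGroup.mk x) := rfl
  rw [h1, AddEquiv.trans_apply, AddEquiv.symm_apply_apply]
  rfl

namespace BundleChart

open SymmetricAlgebra

variable {X : BundleChart}

/-- To obtain the canonical isomorphism, it suffices to have additive maps
`Sym W → Sym L ⊗ (S^q N ⊗ S^{p-q} K)` and `Sym L ⊗ (S^q N ⊗ S^{p-q} K) → Sym W / H` with the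
expected values on the generators, where `H = J ^ (q + 1) I ^ (p - q - 1) + I ^ (p + 1)`, or
`H = I ^ (p + 1)` if `q = p`. -/
theorem exists_iso_of_maps {p q : ℕ} (hq : q ≤ p) (hφ : Function.Surjective X.φ)
    (hε : Function.Surjective X.ε) (g : X.SymW →+ X.T p q)
    (hg : ∀ (a : Fin q → X.ID) (w : Fin (p - q) → LinearMap.ker X.ε) (s : X.SymW),
      g ((∏ j, algebraMap X.A X.SymW (a j)) * (∏ j, ι X.A X.W (w j)) * s) = tGenerator a w s)
    (hg' : ∀ x ∈ nextTerm X.J X.I q (p - q), g x = 0)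
    (τ : X.T p q →+ X.SymW ⧸ nextTerm X.J X.I q (p - q))
    (hτ : ∀ (a : Fin q → X.ID) (w : Fin (p - q) → LinearMap.ker X.ε) (s : X.SymW),
      τ (tGenerator a w s) = Ideal.Quotient.mk _
        ((∏ j, algebraMap X.A X.SymW (a j)) * (∏ j, ι X.A X.W (w j)) * s)) :
    ∃ Φ : X.T p q ≃+ X.Gr p q, ∀ a w s, Φ (tGenerator a w s) = grGenerator hq a w s := by
  let P := X.J ^ q * X.I ^ (p - q)
  let gP : P →+ X.T p q := g.comp (P.subtype : P →+ X.SymW)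
  let γ : P →+ X.Gr p q := (grHom X hq : P →+ X.Gr p q)
  -- `τ ∘ g` is the projection on `P`, hence `g` has the same kernel as `P → gr_q`
  have hτg : ∀ x ∈ P, τ (g x) = Ideal.Quotient.mk _ x := by
    refine mul_induction hφ hε ?_ ?_ ?_
    · intro x y hx hy
      rw [map_add, map_add, hx, hy, map_add]
    · intro x hx
      rw [hg' x hx, map_zero, Ideal.Quotient.eq_zero_iff_mem.mpr hx]
    · intro a w s
      rw [hg, hτ]
  have hgP : Function.Surjective gP := by
    intro x
    induction x using T_induction hφ hε with
    | add x y hx hy =>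
      obtain ⟨u, rfl⟩ := hx
      obtain ⟨v, rfl⟩ := hy
      exact ⟨u + v, map_add _ _ _⟩
    | gen a w s => exact ⟨⟨_, generator_mem a w s⟩, hg a w s⟩
  have hγ : Function.Surjective γ := by
    intro y
    obtain ⟨x, hx, rfl⟩ := grClass_surjective hq y
    exact ⟨⟨x, hx⟩, rfl⟩
  obtain ⟨Φ, hΦ⟩ := exists_addEquiv_of_ker_eq gP γ hgP hγ (by
    rintro ⟨x, hx⟩
    change g x = 0 ↔ grClass hq x hx = 0
    rw [grClass_eq_zero_iff]
    refine ⟨fun h => ?_, hg' x⟩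
    rw [← Ideal.Quotient.eq_zero_iff_mem, ← hτg x hx, h, map_zero])
  refine ⟨Φ, fun a w s => ?_⟩
  rw [← hg]
  exact hΦ ⟨_, generator_mem a w s⟩

end BundleChart

section Lifting

/-- The infinitesimal lifting property of formally smooth algebras, for ring homomorphisms. -/
theorem exists_ringHom_lift {k A E C : Type} [CommRing k] [CommRing A] [CommRing E] [CommRing C]
    [Algebra k A] [Algebra.FormallySmooth k A] (π : E →+* C) (hπ : Function.Surjective π)
    (hn : IsNilpotent (RingHom.ker π)) (f : A →+* C) (h : k →+* E)
    (hf : ∀ r, π (h r) = f (algebraMap k A r)) : ∃ g : A →+* E, ∀ a, π (g a) = f a := by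
  let _ : Algebra k E := h.toAlgebra
  let _ : Algebra k C := (π.comp h).toAlgebra
  let f' : A →ₐ[k] C := { f with commutes' := fun r => (hf r).symm }
  let π' : E →ₐ[k] C := { π with commutes' := fun r => rfl }
  exact ⟨(Algebra.FormallySmooth.liftOfSurjective f' π' hπ hn).toRingHom,
    fun a => Algebra.FormallySmooth.liftOfSurjective_apply f' π' hπ hn a⟩

/-- Lifting of ring homomorphisms from the symmetric algebra of a projective module. -/
theorem exists_symmetricAlgebra_lift {A W E C : Type} [CommRing A] [AddCommGroup W] [Module A W]
    [Module.Projective A W] [CommRing E] [CommRing C] (θ : A →+* E) (π : E →+* C)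
    (hπ : Function.Surjective π) (g : W →ₛₗ[π.comp θ] C) :
    ∃ Ψ : SymmetricAlgebra A W →+* E, (∀ a, Ψ (algebraMap _ _ a) = θ a) ∧
      ∀ w, π (Ψ (SymmetricAlgebra.ι A W w)) = g w := by
  let _ : Algebra A E := θ.toAlgebra
  let _ : Algebra A C := (π.comp θ).toAlgebra
  let π' : E →ₐ[A] C := { π with commutes' := fun r => rfl }
  let g' : W →ₗ[A] C :=
    { toFun := g
      map_add' := map_add g
      map_smul' := fun a w => by
        rw [LinearMap.map_smulₛₗ, Algebra.smul_def]
        rfl }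
  obtain ⟨l, hl⟩ := Module.projective_lifting_property π'.toLinearMap g' hπ
  refine ⟨(SymmetricAlgebra.lift l).toRingHom, fun a => AlgHom.commutes _ a, fun w => ?_⟩
  change π (SymmetricAlgebra.lift l _) = _
  rw [SymmetricAlgebra.lift_ι_apply]
  exact LinearMap.congr_fun hl w

end Lifting

namespace BundleChart

variable {X : BundleChart}

section Conormal

/-- Since `A` and `B` are formally smooth, the conormal sequence
`0 → I_D / I_D² → B ⊗ Ω_A → Ω_B → 0` is split. -/
theorem exists_retraction (k : Type) [CommRing k] [Algebra k X.A] [Algebra k X.B]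
    [IsScalarTower k X.A X.B] [Algebra.FormallySmooth k X.A] [Algebra.FormallySmooth k X.B]
    (hφ : Function.Surjective X.φ) :
    ∃ l : X.B ⊗[X.A] Ω[X.A⁄k] →ₗ[X.A] X.ID.Cotangent,
      l ∘ₗ KaehlerDifferential.kerCotangentToTensor k X.A X.B = LinearMap.id :=
  (Algebra.FormallySmooth.iff_split_injection hφ).mp inferInstance

/-- The conormal module is a direct summand of `B ⊗ Ω_A`, hence projective. -/
theorem projective_N (k : Type) [CommRing k] [Algebra k X.A] [Algebra k X.B]
    [IsScalarTower k X.A X.B] [Algebra.FormallySmooth k X.A] [Algebra.FormallySmooth k X.B]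
    (hφ : Function.Surjective X.φ) : Module.Projective X.B X.N := by
  obtain ⟨l, hl⟩ := exists_retraction k hφ
  let i : X.N →ₗ[X.B] X.B ⊗[X.A] Ω[X.A⁄k] :=
    (KaehlerDifferential.kerCotangentToTensor k X.A X.B).liftBaseChange X.B
  let s : X.B ⊗[X.A] Ω[X.A⁄k] →ₗ[X.B] X.N :=
    LinearMap.extendScalarsOfSurjective hφ (TensorProduct.mk X.A X.B X.ID.Cotangent 1 ∘ₗ l)
  refine Module.Projective.of_split i s (LinearMap.restrictScalars_injective X.A ?_)
  refine LinearMap.ext fun x => ?_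
  obtain ⟨a, rfl⟩ := toN_surjective hφ x
  change (1 : X.B) ⊗ₜ[X.A] l (i (1 ⊗ₜ[X.A] X.ID.toCotangent a)) = _
  have hi : i (1 ⊗ₜ[X.A] X.ID.toCotangent a) =
      KaehlerDifferential.kerCotangentToTensor k X.A X.B (X.ID.toCotangent a) :=
    (LinearMap.liftBaseChange_tmul (R := X.A) X.B _ _ _).trans (one_smul _ _)
  rw [hi]
  exact congrArg (fun c => (1 : X.B) ⊗ₜ[X.A] c) (LinearMap.congr_fun hl (X.ID.toCotangent a))

/-- A derivation `A → N` that extends the projection `I_D → N`. -/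
theorem exists_derivation (k : Type) [CommRing k] [Algebra k X.A] [Algebra k X.B]
    [IsScalarTower k X.A X.B] [Algebra.FormallySmooth k X.A] [Algebra.FormallySmooth k X.B]
    (hφ : Function.Surjective X.φ) :
    ∃ D : Derivation k X.A X.N, ∀ a : X.ID, D a = toN a := by
  obtain ⟨l, hl⟩ := exists_retraction k hφ
  let i : Ω[X.A⁄k] →ₗ[X.A] X.N :=
    TensorProduct.mk X.A X.B X.ID.Cotangent 1 ∘ₗ l ∘ₗ TensorProduct.mk X.A X.B Ω[X.A⁄k] 1
  refine ⟨i.compDer (KaehlerDifferential.D k X.A), fun a => ?_⟩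
  exact congrArg (fun c => (1 : X.B) ⊗ₜ[X.A] c) (LinearMap.congr_fun hl (X.ID.toCotangent a))

end Conormal

end BundleChart

/-! ### The ring `Sym L ⊗ (Sym N ⊗ Sym K)` -/

namespace SymmetricAlgebra

variable (R L N K : Type) [CommRing R] [AddCommGroup L] [Module R L] [AddCommGroup N] [Module R N]
  [AddCommGroup K] [Module R K]

/-- The ring `Sym L ⊗ (Sym N ⊗ Sym K)`. -/
def TripleTensor : Type :=
  SymmetricAlgebra R L ⊗[R] (SymmetricAlgebra R N ⊗[R] SymmetricAlgebra R K)

namespace TripleTensor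

instance : CommRing (TripleTensor R L N K) :=
  inferInstanceAs (CommRing (SymmetricAlgebra R L ⊗[R]
    (SymmetricAlgebra R N ⊗[R] SymmetricAlgebra R K)))

instance : Algebra R (TripleTensor R L N K) :=
  inferInstanceAs (Algebra R (SymmetricAlgebra R L ⊗[R]
    (SymmetricAlgebra R N ⊗[R] SymmetricAlgebra R K)))

/-- The pure tensors in `Sym L ⊗ (Sym N ⊗ Sym K)`. -/
def pure (l : SymmetricAlgebra R L) (n : SymmetricAlgebra R N) (k : SymmetricAlgebra R K) :
    TripleTensor R L N K :=
  l ⊗ₜ[R] (n ⊗ₜ[R] k)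

variable {R L N K} in
theorem pure_mul_pure (l l' : SymmetricAlgebra R L) (n n' : SymmetricAlgebra R N)
    (k k' : SymmetricAlgebra R K) :
    pure R L N K l n k * pure R L N K l' n' k' = pure R L N K (l * l') (n * n') (k * k') := by
  change (l ⊗ₜ[R] (n ⊗ₜ[R] k) : SymmetricAlgebra R L ⊗[R]
    (SymmetricAlgebra R N ⊗[R] SymmetricAlgebra R K)) * (l' ⊗ₜ[R] (n' ⊗ₜ[R] k')) = _
  rw [Algebra.TensorProduct.tmul_mul_tmul, Algebra.TensorProduct.tmul_mul_tmul]
  rfl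

/-- The inclusion of `Sym L` in `Sym L ⊗ (Sym N ⊗ Sym K)`. -/
def inL : SymmetricAlgebra R L →ₐ[R] TripleTensor R L N K :=
  (Algebra.TensorProduct.includeLeft : _ →ₐ[R] SymmetricAlgebra R L ⊗[R]
    (SymmetricAlgebra R N ⊗[R] SymmetricAlgebra R K))

/-- The inclusion of `Sym N` in `Sym L ⊗ (Sym N ⊗ Sym K)`. -/
def inN : SymmetricAlgebra R N →ₐ[R] TripleTensor R L N K :=
  ((Algebra.TensorProduct.includeRight).comp Algebra.TensorProduct.includeLeft :
    _ →ₐ[R] SymmetricAlgebra R L ⊗[R] (SymmetricAlgebra R N ⊗[R] SymmetricAlgebra R K))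

/-- The inclusion of `Sym K` in `Sym L ⊗ (Sym N ⊗ Sym K)`. -/
def inK : SymmetricAlgebra R K →ₐ[R] TripleTensor R L N K :=
  ((Algebra.TensorProduct.includeRight).comp Algebra.TensorProduct.includeRight :
    _ →ₐ[R] SymmetricAlgebra R L ⊗[R] (SymmetricAlgebra R N ⊗[R] SymmetricAlgebra R K))

/-- The ideal of `Sym L ⊗ (Sym N ⊗ Sym K)` generated by `N`. -/
def idN : Ideal (TripleTensor R L N K) := (augIdeal R N).map (inN R L N K)

/-- The ideal of `Sym L ⊗ (Sym N ⊗ Sym K)` generated by `K`. -/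
def idK : Ideal (TripleTensor R L N K) := (augIdeal R K).map (inK R L N K)

/-- The projection of `Sym L ⊗ (Sym N ⊗ Sym K)` to `Sym L ⊗ (S^q N ⊗ S^r K)`. -/
def proj (q r : ℕ) : TripleTensor R L N K →ₗ[R]
    SymmetricAlgebra R L ⊗[R] (symPow R N q ⊗[R] symPow R K r) :=
  TensorProduct.map LinearMap.id
    (TensorProduct.map (projPow (R := R) (M := N) q) (projPow (R := R) (M := K) r))

variable {R L N K}

theorem inN_eq (x : SymmetricAlgebra R N) : inN R L N K x = pure R L N K 1 x 1 := rfl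

theorem inK_eq (x : SymmetricAlgebra R K) : inK R L N K x = pure R L N K 1 1 x := rfl

theorem inL_eq (x : SymmetricAlgebra R L) : inL R L N K x = pure R L N K x 1 1 := rfl

theorem proj_pure (q r : ℕ) (l : SymmetricAlgebra R L) (n : SymmetricAlgebra R N)
    (k : SymmetricAlgebra R K) :
    proj R L N K q r (pure R L N K l n k) = l ⊗ₜ[R] (projPow q n ⊗ₜ[R] projPow r k) := rfl

theorem pure_induction {motive : TripleTensor R L N K → Prop} (zero : motive 0)
    (add : ∀ x y, motive x → motive y → motive (x + y))
    (pure : ∀ l n k, motive (pure R L N K l n k)) (x : TripleTensor R L N K) : motive x := by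
  refine TensorProduct.induction_on (motive := motive) x zero (fun l z => ?_) add
  refine TensorProduct.induction_on
    (motive := fun z => motive (l ⊗ₜ[R] z :
      SymmetricAlgebra R L ⊗[R] (SymmetricAlgebra R N ⊗[R] SymmetricAlgebra R K)))
    z ?_ (fun n k => pure l n k) (fun a b ha hb => ?_)
  · rw [TensorProduct.tmul_zero]
    exact zero
  · rw [TensorProduct.tmul_add]
    exact add _ _ ha hb

/-- To show that the projection vanishes on an extended ideal, it suffices to test products of a
pure tensor and an element of the ideal. -/
theorem proj_map_eq_zero {S : Type} [CommRing S] (f : S →+* TripleTensor R L N K) (I : Ideal S)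
    (q r : ℕ) (h : ∀ y ∈ I, ∀ l n k, proj R L N K q r (pure R L N K l n k * f y) = 0) :
    ∀ x ∈ I.map f, proj R L N K q r x = 0 := by
  intro x hx
  have key : ∀ t, proj R L N K q r (t * x) = 0 := by
    refine Submodule.span_induction (p := fun x _ => ∀ t, proj R L N K q r (t * x) = 0)
      ?_ ?_ ?_ ?_ hx
    · rintro _ ⟨y, hy, rfl⟩ t
      induction t using pure_induction with
      | zero => rw [zero_mul, map_zero]
      | add a b ha hb => rw [add_mul, map_add, ha, hb, add_zero]
      | pure l n k => exact h y hy l n k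
    · intro t
      rw [mul_zero, map_zero]
    · intro a b _ _ ha hb t
      rw [mul_add, map_add, ha, hb, add_zero]
    · intro s a _ ha t
      rw [smul_eq_mul, ← mul_assoc]
      exact ha (t * s)
  rw [← one_mul x]
  exact key 1

/-- The elements of order `> q` in `N` have no component in `S^q N`. -/
theorem proj_idN (q r : ℕ) : ∀ x ∈ idN R L N K ^ (q + 1), proj R L N K q r x = 0 := by
  intro x hx
  have e : idN R L N K ^ (q + 1) = (augIdeal R N ^ (q + 1)).map (inN R L N K).toRingHom :=
    (Ideal.map_pow (inN R L N K).toRingHom (augIdeal R N) (q + 1)).symm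
  rw [e] at hx
  refine proj_map_eq_zero _ _ q r (fun y hy l n k => ?_) x hx
  change proj R L N K q r (_ * inN R L N K y) = 0
  rw [inN_eq, pure_mul_pure, proj_pure,
    projPow_eq_zero (Nat.lt_succ_self q) (Ideal.mul_mem_left _ n hy),
    TensorProduct.zero_tmul, TensorProduct.tmul_zero]

/-- The elements of order `> r` in `K` have no component in `S^r K`. -/
theorem proj_idK (q r : ℕ) : ∀ x ∈ idK R L N K ^ (r + 1), proj R L N K q r x = 0 := by
  intro x hx
  have e : idK R L N K ^ (r + 1) = (augIdeal R K ^ (r + 1)).map (inK R L N K).toRingHom :=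
    (Ideal.map_pow (inK R L N K).toRingHom (augIdeal R K) (r + 1)).symm
  rw [e] at hx
  refine proj_map_eq_zero _ _ q r (fun y hy l n k => ?_) x hx
  change proj R L N K q r (_ * inK R L N K y) = 0
  rw [inK_eq, pure_mul_pure, proj_pure,
    projPow_eq_zero (Nat.lt_succ_self r) (Ideal.mul_mem_left _ k hy),
    TensorProduct.tmul_zero, TensorProduct.tmul_zero]

/-- The projection to `Sym L ⊗ (S^q N ⊗ S^r K)` vanishes on everything of order `> q` in `N`, or
of total order `> q + r`. -/
theorem proj_nextTerm (q r : ℕ) :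
    ∀ x ∈ nextTerm (idN R L N K) (idN R L N K ⊔ idK R L N K) q r, proj R L N K q r x = 0 := by
  intro x hx
  have h1 : nextTerm (idN R L N K) (idN R L N K ⊔ idK R L N K) q r ≤
      idN R L N K ^ (q + 1) ⊔ idK R L N K ^ (r + 1) :=
    (nextTerm_le_sup _ _ _ _).trans (sup_le le_sup_left (Ideal.sup_pow_succ_le _ _ _ _))
  obtain ⟨y, hy, z, hz, rfl⟩ := Submodule.mem_sup.mp (h1 hx)
  rw [map_add, proj_idN q r y hy, proj_idK q r z hz, add_zero]

theorem proj_prod {q r : ℕ} (n : Fin q → N) (k : Fin r → K) (l : SymmetricAlgebra R L) :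
    proj R L N K q r ((∏ j, inN R L N K (ι R N (n j))) * (∏ j, inK R L N K (ι R K (k j))) *
      inL R L N K l) = l ⊗ₜ[R] (symProd n ⊗ₜ[R] symProd k) := by
  have eN : ∏ j, inN R L N K (ι R N (n j)) = inN R L N K (symProd n : symPow R N q) :=
    (map_prod (inN R L N K) _ _).symm
  have eK : ∏ j, inK R L N K (ι R K (k j)) = inK R L N K (symProd k : symPow R K r) :=
    (map_prod (inK R L N K) _ _).symm
  rw [eN, eK, inN_eq, inK_eq, inL_eq, pure_mul_pure, pure_mul_pure, proj_pure, one_mul, one_mul,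
    mul_one, mul_one, one_mul, mul_one, projPow_coe, projPow_coe]

end TripleTensor

end SymmetricAlgebra

namespace BundleChart

open SymmetricAlgebra

variable {X : BundleChart}

/-- A projection of `W_D` onto `K`: the sequence `0 → K → W_D → L → 0` is split. -/
theorem exists_projection_K [Module.Projective X.B X.L]
    (hε : Function.Surjective X.ε) : ∃ ρ : X.WD →ₗ[X.B] X.K, ∀ x : X.K, ρ x = x := by
  have hεD : Function.Surjective X.εD := fun l => by
    obtain ⟨w, rfl⟩ := hε l
    exact ⟨_, εD_one_tmul w⟩
  obtain ⟨σ, hσ⟩ := Module.projective_lifting_property X.εD LinearMap.id hεD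
  have hmem : ∀ x, (LinearMap.id - σ ∘ₗ X.εD : X.WD →ₗ[X.B] X.WD) x ∈ X.K := fun x => by
    change X.εD (x - σ (X.εD x)) = 0
    rw [map_sub, sub_eq_zero]
    exact (LinearMap.congr_fun hσ (X.εD x)).symm
  refine ⟨LinearMap.codRestrict X.K _ hmem, fun x => Subtype.ext ?_⟩
  have h : X.εD (x : X.WD) = 0 := x.2
  change (x : X.WD) - σ (X.εD x) = x
  rw [h, map_zero, sub_zero]

theorem projective_K [Module.Projective X.A X.W] [Module.Projective X.B X.L]
    (hε : Function.Surjective X.ε) : Module.Projective X.B X.K := by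
  obtain ⟨ρ, hρ⟩ := exists_projection_K hε
  exact Module.Projective.of_split X.K.subtype ρ (LinearMap.ext hρ)

end BundleChart

/-! ### From `Sym W` to `Sym L ⊗ (S^q N ⊗ S^{p-q} K)` -/

/-- A homomorphism from a formally smooth algebra to `T ⧸ 𝔞` lifts to `T ⧸ 𝔞 ^ (n + 1)`. -/
theorem exists_ringHom_lift_pow {k A T : Type} [CommRing k] [CommRing A] [CommRing T]
    [Algebra k A] [Algebra.FormallySmooth k A] (𝔞 : Ideal T) (n : ℕ) (f : A →+* T ⧸ 𝔞)
    (h : k →+* T) (hf : ∀ r, Ideal.Quotient.mk 𝔞 (h r) = f (algebraMap k A r)) :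
    ∃ θ : A →+* T ⧸ 𝔞 ^ (n + 1), ∀ a t, f a = Ideal.Quotient.mk 𝔞 t →
      θ a - Ideal.Quotient.mk (𝔞 ^ (n + 1)) t ∈ 𝔞.map (Ideal.Quotient.mk (𝔞 ^ (n + 1))) := by
  have hle : 𝔞 ^ (n + 1) ≤ 𝔞 := Ideal.pow_le_self (Nat.succ_ne_zero n)
  have hker : RingHom.ker (Ideal.Quotient.factor hle) =
      𝔞.map (Ideal.Quotient.mk (𝔞 ^ (n + 1))) := Ideal.Quotient.factor_ker hle
  obtain ⟨θ, hθ⟩ := exists_ringHom_lift (Ideal.Quotient.factor hle)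
    (Ideal.Quotient.factor_surjective hle) (by
      refine ⟨n + 1, ?_⟩
      rw [hker, ← Ideal.map_pow, Ideal.map_quotient_self]
      rfl) f ((Ideal.Quotient.mk _).comp h) hf
  refine ⟨θ, fun a t hat => ?_⟩
  rw [← hker, RingHom.mem_ker, map_sub, hθ, hat, Ideal.Quotient.factor_mk, sub_self]

/-- Lifting of ring homomorphisms from the symmetric algebra of a projective module, for an additive
map `lin` that is only linear modulo an ideal. -/
theorem exists_symmetricAlgebra_lift_of_sub_mem {A W E : Type} [CommRing A] [AddCommGroup W]
    [Module A W] [Module.Projective A W] [CommRing E] (θ : A →+* E) (𝔫 : Ideal E) (lin : W →+ E)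
    (h : ∀ a w, lin (a • w) - θ a * lin w ∈ 𝔫) :
    ∃ Ψ : SymmetricAlgebra A W →+* E, (∀ a, Ψ (algebraMap _ _ a) = θ a) ∧
      ∀ w, Ψ (SymmetricAlgebra.ι A W w) - lin w ∈ 𝔫 := by
  let g : W →ₛₗ[(Ideal.Quotient.mk 𝔫).comp θ] E ⧸ 𝔫 :=
    { toFun := fun w => Ideal.Quotient.mk 𝔫 (lin w)
      map_add' := fun x y => by simp only [map_add]
      map_smul' := fun a w => (Ideal.Quotient.eq.mpr (h a w)).trans (map_mul _ _ _) }
  obtain ⟨Ψ, h1, h2⟩ := exists_symmetricAlgebra_lift θ (Ideal.Quotient.mk 𝔫)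
    Ideal.Quotient.mk_surjective g
  exact ⟨Ψ, h1, fun w => Ideal.Quotient.eq.mp (h2 w)⟩

/-- Two homomorphisms from a symmetric algebra are congruent modulo an ideal if they are so on
scalars and on elements of degree one. -/
theorem symmetricAlgebra_sub_mem {A W E : Type} [CommRing A] [AddCommGroup W] [Module A W]
    [CommRing E] (f g : SymmetricAlgebra A W →+* E) (𝔪 : Ideal E)
    (hA : ∀ a, f (algebraMap A _ a) - g (algebraMap A _ a) ∈ 𝔪)
    (hW : ∀ w, f (SymmetricAlgebra.ι A W w) - g (SymmetricAlgebra.ι A W w) ∈ 𝔪)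
    (s : SymmetricAlgebra A W) : f s - g s ∈ 𝔪 := by
  induction s using SymmetricAlgebra.induction with
  | algebraMap a => exact hA a
  | ι w => exact hW w
  | mul a b ha hb =>
    convert add_mem (Ideal.mul_mem_right (f b) _ ha) (Ideal.mul_mem_left _ (g a) hb) using 1
    simp only [map_mul]
    ring
  | add a b ha hb =>
    convert add_mem ha hb using 1
    simp only [map_add]
    ring

namespace BundleChart

open SymmetricAlgebra

variable (X : BundleChart)

/-- The ring `Sym L ⊗ (Sym N ⊗ Sym K)`. -/
abbrev TT : Type := TripleTensor X.B X.L X.N X.K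

/-- The inclusion of `Sym L` in `Sym L ⊗ (Sym N ⊗ Sym K)`. -/
abbrev inL : X.SymL →ₐ[X.B] X.TT := TripleTensor.inL X.B X.L X.N X.K

/-- The inclusion of `Sym N` in `Sym L ⊗ (Sym N ⊗ Sym K)`. -/
abbrev inN : SymmetricAlgebra X.B X.N →ₐ[X.B] X.TT := TripleTensor.inN X.B X.L X.N X.K

/-- The inclusion of `Sym K` in `Sym L ⊗ (Sym N ⊗ Sym K)`. -/
abbrev inK : SymmetricAlgebra X.B X.K →ₐ[X.B] X.TT := TripleTensor.inK X.B X.L X.N X.K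

/-- The ideal of `Sym L ⊗ (Sym N ⊗ Sym K)` generated by `N`. -/
abbrev idN : Ideal X.TT := TripleTensor.idN X.B X.L X.N X.K

/-- The ideal of `Sym L ⊗ (Sym N ⊗ Sym K)` generated by `K`. -/
abbrev idK : Ideal X.TT := TripleTensor.idK X.B X.L X.N X.K

variable {X}

theorem inN_ι_mem (n : X.N) : X.inN (ι X.B X.N n) ∈ X.idN :=
  Ideal.mem_map_of_mem X.inN (ι_mem_augIdeal n)

theorem inK_ι_mem (k : X.K) : X.inK (ι X.B X.K k) ∈ X.idK :=
  Ideal.mem_map_of_mem X.inK (ι_mem_augIdeal k)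

/-- The ring homomorphism `a ↦ φ a + D a` modulo the square of the ideal generated by `N`. -/
def derivationHom {k : Type} [CommRing k] [Algebra k X.A] [Algebra k X.B]
    [IsScalarTower k X.A X.B] (D : Derivation k X.A X.N) :
    X.A →+* X.TT ⧸ X.idN ^ 2 where
  toFun a := Ideal.Quotient.mk _ (algebraMap X.B X.TT (X.φ a) + X.inN (ι X.B X.N (D a)))
  map_one' := by simp
  map_zero' := by simp
  map_add' a b := by
    rw [← map_add]
    congr 1
    simp only [map_add]
    ring
  map_mul' a b := by
    rw [← map_mul, Ideal.Quotient.eq]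
    have h : D (a * b) = X.φ a • D b + X.φ b • D a := by
      rw [Derivation.leibniz]
      rfl
    have h2 : X.inN (ι X.B X.N (D (a * b))) =
        algebraMap X.B X.TT (X.φ a) * X.inN (ι X.B X.N (D b)) +
        algebraMap X.B X.TT (X.φ b) * X.inN (ι X.B X.N (D a)) := by
      rw [h, map_add, map_smul, map_smul, map_add, map_smul, map_smul, Algebra.smul_def,
        Algebra.smul_def]
    have h3 := Ideal.mul_mem_mul (inN_ι_mem (D a)) (inN_ι_mem (D b))
    rw [← pow_two] at h3
    rw [h2, map_mul, map_mul, ← neg_mem_iff]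
    convert h3 using 1
    ring

/-- The map `w ↦ ρ w + ε w`, where `ρ` is a projection of `W_D` onto `K`. -/
def expansionLin (ρ : X.WD →ₗ[X.B] X.K) : X.W →+ X.TT where
  toFun w := X.inK (ι X.B X.K (ρ (1 ⊗ₜ[X.A] w))) + X.inL (ι X.B X.L (X.ε w))
  map_zero' := by simp
  map_add' x y := by
    simp only [map_add, TensorProduct.tmul_add]
    ring

theorem expansionLin_smul (ρ : X.WD →ₗ[X.B] X.K) (a : X.A) (w : X.W) :
    expansionLin ρ (a • w) = algebraMap X.B X.TT (X.φ a) * expansionLin ρ w := by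
  have h : (1 : X.B) ⊗ₜ[X.A] (a • w) = X.φ a • ((1 : X.B) ⊗ₜ[X.A] w) := by
    rw [← TensorProduct.smul_tmul, TensorProduct.smul_tmul']
    congr 1
  have h2 : X.ε (a • w) = X.φ a • X.ε w := LinearMap.map_smulₛₗ _ _ _
  change X.inK (ι X.B X.K (ρ (1 ⊗ₜ[X.A] (a • w)))) + X.inL (ι X.B X.L (X.ε (a • w))) =
    _ * (X.inK (ι X.B X.K (ρ (1 ⊗ₜ[X.A] w))) + X.inL (ι X.B X.L (X.ε w)))
  rw [h, h2, LinearMap.map_smul ρ, LinearMap.map_smul (ι X.B X.K), LinearMap.map_smul (ι X.B X.L),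
    map_smul X.inK, map_smul X.inL, mul_add, Algebra.smul_def, Algebra.smul_def]

set_option maxHeartbeats 1000000 in
/-- A ring homomorphism from `Sym W` to the quotient of `Sym L ⊗ (Sym N ⊗ Sym K)` by a power of the
ideal generated by `N`, with the expected leading terms: `a ∈ I_D` maps to its class in `N` to second
order in `N`, an element `w` of the kernel of `ε` to its image in `K` modulo `N`, and `s` to `Sym ε s`
modulo `N` and `K`. -/
theorem exists_expansion (k : Type) [CommRing k] [Algebra k X.A] [Algebra k X.B]
    [IsScalarTower k X.A X.B] [Algebra.FormallySmooth k X.A] [Algebra.FormallySmooth k X.B]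
    [Module.Projective X.A X.W] [Module.Projective X.B X.L]
    (hφ : Function.Surjective X.φ) (hε : Function.Surjective X.ε) (n : ℕ) :
    ∃ Ψ : X.SymW →+* X.TT ⧸ (X.idN ^ 2) ^ (n + 1),
      (∀ a : X.ID, Ψ (algebraMap X.A X.SymW a) - Ideal.Quotient.mk _ (X.inN (ι X.B X.N (toN a))) ∈
        (X.idN.map (Ideal.Quotient.mk ((X.idN ^ 2) ^ (n + 1)))) ^ 2) ∧
      (∀ w : LinearMap.ker X.ε,
        Ψ (ι X.A X.W w) - Ideal.Quotient.mk _ (X.inK (ι X.B X.K (toK w))) ∈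
          X.idN.map (Ideal.Quotient.mk ((X.idN ^ 2) ^ (n + 1)))) ∧
      ∀ s, Ψ s - Ideal.Quotient.mk _ (X.inL (X.symε s)) ∈
        (X.idN ⊔ X.idK).map (Ideal.Quotient.mk ((X.idN ^ 2) ^ (n + 1))) := by
  obtain ⟨D, hD⟩ := exists_derivation k hφ
  obtain ⟨ρ, hρ⟩ := exists_projection_K hε
  -- `(idN ^ 2) ^ (n + 1)` is a power of `idN ^ 2`, where `derivationHom` is defined
  set E := X.TT ⧸ (X.idN ^ 2) ^ (n + 1)
  set mk : X.TT →+* E := Ideal.Quotient.mk ((X.idN ^ 2) ^ (n + 1))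
  set 𝔫 : Ideal E := X.idN.map mk with h𝔫
  obtain ⟨θ, hθ⟩ := exists_ringHom_lift_pow (k := k) (X.idN ^ 2) n (derivationHom D)
    ((algebraMap X.B X.TT).comp (X.φ.comp (algebraMap k X.A))) (fun r => by
      change _ = Ideal.Quotient.mk _ _
      rw [Derivation.map_algebraMap, map_zero, map_zero, add_zero]
      rfl)
  -- `θ a` is `φ a + D a` to second order, and in particular `φ a` to first order
  have hθ' : ∀ a, θ a - mk (algebraMap X.B X.TT (X.φ a) + X.inN (ι X.B X.N (D a))) ∈ 𝔫 ^ 2 :=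
    fun a => by
      rw [h𝔫, ← Ideal.map_pow]
      exact hθ a _ rfl
  have hθφ : ∀ a, θ a - mk (algebraMap X.B X.TT (X.φ a)) ∈ 𝔫 := fun a => by
    have h1 := Ideal.pow_le_self two_ne_zero (hθ' a)
    have h2 : mk (X.inN (ι X.B X.N (D a))) ∈ 𝔫 := Ideal.mem_map_of_mem mk (inN_ι_mem (D a))
    convert add_mem h1 h2 using 1
    rw [map_add]
    ring
  have hlin : ∀ (a : X.A) (w : X.W), expansionLin ρ (a • w) =
      algebraMap X.B X.TT (X.φ a) * expansionLin ρ w := expansionLin_smul ρ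
  obtain ⟨Ψ, hΨA, hW⟩ := exists_symmetricAlgebra_lift_of_sub_mem θ 𝔫
    ((mk : X.TT →+ E).comp (expansionLin ρ)) (fun a w => by
      have h := Ideal.mul_mem_right (mk (expansionLin ρ w)) _ (hθφ a)
      rw [← neg_mem_iff]
      convert h using 1
      change -(mk (expansionLin ρ (a • w)) - θ a * mk (expansionLin ρ w)) = _
      rw [hlin, map_mul]
      ring)
  replace hW : ∀ w, Ψ (ι X.A X.W w) - mk (X.inK (ι X.B X.K (ρ (1 ⊗ₜ[X.A] w))) +
    X.inL (ι X.B X.L (X.ε w))) ∈ 𝔫 := hW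
  have h𝔪 : 𝔫 ≤ (X.idN ⊔ X.idK).map mk := Ideal.map_mono le_sup_left
  refine ⟨Ψ, fun a => ?_, fun w => ?_, fun s => ?_⟩
  · have h := hθ' a
    have ha : X.φ (a : X.A) = 0 := a.2
    rwa [hD, ha, map_zero, zero_add, ← hΨA] at h
  · have h := hW w
    have hw : X.ε (w : X.W) = 0 := w.2
    have e : ρ (1 ⊗ₜ[X.A] (w : X.W)) = toK w := hρ (toK w)
    rwa [e, hw, map_zero, map_zero, add_zero] at h
  · refine symmetricAlgebra_sub_mem Ψ (mk.comp ((X.inL : X.SymL →+* X.TT).comp X.symε)) _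
      (fun a => ?_) (fun w => ?_) s
    · change Ψ _ - mk (X.inL (X.symε (algebraMap X.A X.SymW a))) ∈ _
      rw [hΨA, symε, symMap_algebraMap, AlgHom.commutes]
      exact h𝔪 (hθφ a)
    · change Ψ _ - mk (X.inL (X.symε (ι X.A X.W w))) ∈ _
      have h1 := h𝔪 (hW w)
      have h2 : mk (X.inK (ι X.B X.K (ρ (1 ⊗ₜ[X.A] w)))) ∈ (X.idN ⊔ X.idK).map mk :=
        Ideal.mem_map_of_mem mk (le_sup_right (a := X.idN) (inK_ι_mem _))
      rw [symε, symMap_ι]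
      convert add_mem h1 h2 using 1
      rw [map_add]
      ring

set_option maxHeartbeats 1000000 in
/-- The additive map `Sym W → Sym L ⊗ (S^q N ⊗ S^{p-q} K)` that takes the expected values on
generators. -/
theorem exists_leadingTerm (k : Type) [CommRing k] [Algebra k X.A] [Algebra k X.B]
    [IsScalarTower k X.A X.B] [Algebra.FormallySmooth k X.A] [Algebra.FormallySmooth k X.B]
    [Module.Projective X.A X.W] [Module.Projective X.B X.L]
    (hφ : Function.Surjective X.φ) (hε : Function.Surjective X.ε) (p q : ℕ) :
    ∃ g : X.SymW →+ X.T p q,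
      (∀ (a : Fin q → X.ID) (w : Fin (p - q) → LinearMap.ker X.ε) (s : X.SymW),
        g ((∏ j, algebraMap X.A X.SymW (a j)) * (∏ j, ι X.A X.W (w j)) * s) =
          tGenerator a w s) ∧
      ∀ x ∈ nextTerm X.J X.I q (p - q), g x = 0 := by
  obtain ⟨Ψ, h1, h2, h3⟩ := exists_expansion k hφ hε q
  set E := X.TT ⧸ (X.idN ^ 2) ^ (q + 1)
  set mk : X.TT →+* E := Ideal.Quotient.mk ((X.idN ^ 2) ^ (q + 1))
  have hmk : Function.Surjective mk := Ideal.Quotient.mk_surjective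
  let pr : X.TT →+ X.T p q := (TripleTensor.proj X.B X.L X.N X.K q (p - q)).toAddMonoidHom
  have hpr : ∀ x ∈ (X.idN ^ 2) ^ (q + 1), pr x = 0 := fun x hx => by
    rw [← pow_mul] at hx
    exact TripleTensor.proj_idN q (p - q) x (Ideal.pow_le_pow_right (by omega) hx)
  -- `2 (q + 1) > q`, so the projection factors through the thickening
  let prE : E →+ X.T p q := QuotientAddGroup.lift _ pr hpr
  have hprE : ∀ x, prE (mk x) = pr x := fun x => rfl
  have hnext : ∀ y ∈ nextTerm (X.idN.map mk) ((X.idN ⊔ X.idK).map mk) q (p - q), prE y = 0 := by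
    intro y hy
    rw [← map_nextTerm] at hy
    obtain ⟨x, hx, rfl⟩ := (Ideal.mem_map_iff_of_surjective mk hmk).mp hy
    exact TripleTensor.proj_nextTerm q (p - q) x hx
  have hnm : X.idN.map mk ≤ (X.idN ⊔ X.idK).map mk := Ideal.map_mono le_sup_left
  have hJ : X.J.map Ψ ≤ X.idN.map mk := by
    rw [J, Ideal.map_map, Ideal.map_le_iff_le_comap]
    intro a ha
    have h := add_mem (Ideal.pow_le_self two_ne_zero (h1 ⟨a, ha⟩))
      (Ideal.mem_map_of_mem mk (inN_ι_mem (toN ⟨a, ha⟩)))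
    rwa [sub_add_cancel] at h
  have hI : X.I.map Ψ ≤ (X.idN ⊔ X.idK).map mk := by
    rw [Ideal.map_le_iff_le_comap]
    intro s hs
    have h := h3 s
    have hs : X.symε s = 0 := hs
    rwa [hs, map_zero, map_zero, sub_zero] at h
  refine ⟨prE.comp (Ψ : X.SymW →+ E), fun a w s => ?_, fun x hx => ?_⟩
  · have key := prod_mul_prod_mul_sub_mem hnm (q := q) (r := p - q)
      (x := fun j => Ψ (algebraMap X.A X.SymW (a j)))
      (x' := fun j => mk (X.inN (ι X.B X.N (toN (a j)))))
      (y := fun j => Ψ (ι X.A X.W (w j)))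
      (y' := fun j => mk (X.inK (ι X.B X.K (toK (w j)))))
      (z := Ψ s) (z' := mk (X.inL (X.symε s)))
      (fun j => h1 (a j)) (fun j => Ideal.mem_map_of_mem mk (inN_ι_mem _))
      (fun j => h2 (w j))
      (fun j => Ideal.mem_map_of_mem mk (le_sup_right (a := X.idN) (inK_ι_mem _))) (h3 s)
    have h0 := hnext _ key
    rw [map_sub, sub_eq_zero] at h0
    change prE (Ψ _) = _
    have e : Ψ ((∏ j, algebraMap X.A X.SymW (a j)) * (∏ j, ι X.A X.W (w j)) * s) =
        (∏ j, Ψ (algebraMap X.A X.SymW (a j))) * (∏ j, Ψ (ι X.A X.W (w j))) * Ψ s := by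
      rw [map_mul, map_mul, map_prod, map_prod]
    have e' : (∏ j, mk (X.inN (ι X.B X.N (toN (a j))))) *
        (∏ j, mk (X.inK (ι X.B X.K (toK (w j))))) * mk (X.inL (X.symε s)) =
        mk ((∏ j, X.inN (ι X.B X.N (toN (a j)))) * (∏ j, X.inK (ι X.B X.K (toK (w j)))) *
          X.inL (X.symε s)) := by
      rw [map_mul mk, map_mul mk, map_prod mk, map_prod mk]
    rw [e, h0, e', hprE]
    exact TripleTensor.proj_prod (fun j => toN (a j)) (fun j => toK (w j)) (X.symε s)
  · refine hnext _ (nextTerm_mono hJ hI q (p - q) ?_)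
    rw [← map_nextTerm]
    exact Ideal.mem_map_of_mem Ψ hx

end BundleChart

/-! ### From `Sym L ⊗ (S^q N ⊗ S^{p-q} K)` to quotients of `Sym W` -/

/-- If `A → B` is surjective, then the kernel of `M → B ⊗ M` is generated by the products with
elements of the kernel of `A → B`. -/
theorem mem_smul_top_of_one_tmul_eq_zero {A B M : Type} [CommRing A] [CommRing B] [Algebra A B]
    [AddCommGroup M] [Module A M] (h : Function.Surjective (algebraMap A B)) {m : M}
    (hm : (1 : B) ⊗ₜ[A] m = 0) : m ∈ RingHom.ker (algebraMap A B) • (⊤ : Submodule A M) := by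
  let e : (A ⧸ RingHom.ker (algebraMap A B)) ≃ₐ[A] B :=
    Ideal.quotientKerAlgEquivOfSurjective (f := Algebra.ofId A B) h
  rw [← LinearMap.ker_tensorProductMk, LinearMap.mem_ker]
  have h2 : e.symm.toLinearMap.rTensor M ((1 : B) ⊗ₜ[A] m) =
      (1 : A ⧸ RingHom.ker (algebraMap A B)) ⊗ₜ[A] m := by
    rw [LinearMap.rTensor_tmul]
    congr 1
    exact map_one e.symm
  rw [TensorProduct.mk_apply, ← h2, hm, map_zero]

/-- Lifting of ring homomorphisms from the symmetric algebra of a projective module `L`, for a map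
`lin` defined on a module `W` with a surjection onto `L`. -/
theorem exists_symmetricAlgebra_lift_of_surjective {A B W L E : Type} [CommRing A] [CommRing B]
    [AddCommGroup W] [Module A W] [AddCommGroup L] [Module B L] [Module.Projective B L]
    [CommRing E] (φ : A →+* B) (hφ : Function.Surjective φ) (e : W →+ L)
    (he : Function.Surjective e) (he' : ∀ a w, e (a • w) = φ a • e w) (β : B →+* E) (𝔪 : Ideal E)
    (lin : W →+ E) (h : ∀ a w, lin (a • w) - β (φ a) * lin w ∈ 𝔪)
    (hker : ∀ w, e w = 0 → lin w ∈ 𝔪) :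
    ∃ Ψ : SymmetricAlgebra B L →+* E, (∀ b, Ψ (algebraMap _ _ b) = β b) ∧
      ∀ w, Ψ (SymmetricAlgebra.ι B L (e w)) - lin w ∈ 𝔪 := by
  let lin' : W →+ E ⧸ 𝔪 := (Ideal.Quotient.mk 𝔪 : E →+ E ⧸ 𝔪).comp lin
  let g : L →+ E ⧸ 𝔪 := AddMonoidHom.liftOfSurjective e he
    ⟨lin', fun w hw => Ideal.Quotient.eq_zero_iff_mem.mpr (hker w hw)⟩
  have hg : ∀ w, g (e w) = Ideal.Quotient.mk 𝔪 (lin w) := fun w =>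
    AddMonoidHom.liftOfRightInverse_comp_apply e _ _ _ w
  let g' : L →ₛₗ[(Ideal.Quotient.mk 𝔪).comp β] E ⧸ 𝔪 :=
    { toFun := g
      map_add' := map_add g
      map_smul' := fun b l => by
        obtain ⟨a, rfl⟩ := hφ b
        obtain ⟨w, rfl⟩ := he l
        rw [← he', hg, hg]
        exact (Ideal.Quotient.eq.mpr (h a w)).trans (map_mul _ _ _) }
  obtain ⟨Ψ, h1, h2⟩ := exists_symmetricAlgebra_lift β (Ideal.Quotient.mk 𝔪)
    Ideal.Quotient.mk_surjective g'
  exact ⟨Ψ, h1, fun w => Ideal.Quotient.eq.mp ((h2 (e w)).trans (hg w))⟩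

/-- The additive map on `Sym L ⊗ (S^q N ⊗ S^r K)` obtained by multiplying ring homomorphisms on
`Sym L`, `Sym N` and `Sym K`. -/
theorem exists_tensor_mul {R L N K E : Type} [CommRing R] [AddCommGroup L] [Module R L]
    [AddCommGroup N] [Module R N] [AddCommGroup K] [Module R K] [CommRing E] (β : R →+* E)
    (f : SymmetricAlgebra R L →+* E) (g : SymmetricAlgebra R N →+* E)
    (h : SymmetricAlgebra R K →+* E) (hf : ∀ r, f (algebraMap R _ r) = β r)
    (hg : ∀ r, g (algebraMap R _ r) = β r) (hh : ∀ r, h (algebraMap R _ r) = β r) (q r : ℕ) :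
    ∃ τ : SymmetricAlgebra R L ⊗[R] (symPow R N q ⊗[R] symPow R K r) →+ E,
      ∀ l n k, τ (l ⊗ₜ[R] (n ⊗ₜ[R] k)) = f l * (g n * h k) := by
  let _ : Algebra R E := β.toAlgebra
  let f' : SymmetricAlgebra R L →ₐ[R] E := { f with commutes' := hf }
  let g' : SymmetricAlgebra R N →ₐ[R] E := { g with commutes' := hg }
  let h' : SymmetricAlgebra R K →ₐ[R] E := { h with commutes' := hh }
  let τ : SymmetricAlgebra R L ⊗[R] (symPow R N q ⊗[R] symPow R K r) →ₗ[R] E :=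
    LinearMap.mul' R E ∘ₗ TensorProduct.map f'.toLinearMap
      (LinearMap.mul' R E ∘ₗ TensorProduct.map (g'.toLinearMap ∘ₗ (symPow R N q).subtype)
        (h'.toLinearMap ∘ₗ (symPow R K r).subtype))
  exact ⟨τ.toAddMonoidHom, fun l n k => rfl⟩

namespace BundleChart

open SymmetricAlgebra

variable {X : BundleChart}

/-- The module `N = B ⊗ I_D / I_D²` is `I_D / I_D²` itself, as `I_D` annihilates the latter. -/
theorem mem_ID_sq_of_toN_eq_zero (hφ : Function.Surjective X.φ) {a : X.ID} (h : toN a = 0) :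
    (a : X.A) ∈ X.ID ^ 2 := by
  have h1 : X.ID.toCotangent a ∈ X.ID • (⊤ : Submodule X.A X.ID.Cotangent) :=
    mem_smul_top_of_one_tmul_eq_zero (B := X.B) hφ h
  rw [← Ideal.toCotangent_eq_zero]
  have h2 : X.ID • (⊤ : Submodule X.A X.ID.Cotangent) = ⊥ := by
    rw [eq_bot_iff, Submodule.smul_le]
    intro r hr n _
    obtain ⟨y, rfl⟩ := X.ID.toCotangent_surjective n
    rw [Submodule.mem_bot, ← map_smul, Ideal.toCotangent_eq_zero, pow_two]
    exact Ideal.mul_mem_mul hr y.2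
  rwa [h2, Submodule.mem_bot] at h1

theorem ι_mem_J_of_one_tmul_eq_zero (hφ : Function.Surjective X.φ) {w : X.W}
    (h : (1 : X.B) ⊗ₜ[X.A] w = 0) : ι X.A X.W w ∈ X.J := by
  have h1 : w ∈ X.ID • (⊤ : Submodule X.A X.W) := mem_smul_top_of_one_tmul_eq_zero (B := X.B) hφ h
  refine Submodule.smul_induction_on h1 (fun a ha w _ => ?_) (fun x y hx hy => ?_)
  · rw [map_smul, Algebra.smul_def]
    exact Ideal.mul_mem_right _ _ (Ideal.mem_map_of_mem _ ha)
  · rw [map_add]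
    exact add_mem hx hy

/-- Since `B` is formally smooth, the ring homomorphism `B → Sym W / J` induced by `A → Sym W` lifts to
`Sym W / H`, if `H` contains a power of `J`. -/
theorem exists_section (k : Type) [CommRing k] [Algebra k X.A] [Algebra k X.B]
    [IsScalarTower k X.A X.B] [Algebra.FormallySmooth k X.B]
    (hφ : Function.Surjective X.φ) (n : ℕ) (H : Ideal X.SymW) (hH : X.J ^ (n + 1) ≤ H) :
    ∃ β : X.B →+* X.SymW ⧸ H, ∀ a, β (X.φ a) - Ideal.Quotient.mk H (algebraMap X.A X.SymW a) ∈
      X.J.map (Ideal.Quotient.mk H) := by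
  let f₀ : X.A →+* X.SymW ⧸ X.J := (Ideal.Quotient.mk X.J).comp (algebraMap X.A X.SymW)
  have hf₀ : RingHom.ker X.φ ≤ RingHom.ker f₀ := fun a ha =>
    Ideal.Quotient.eq_zero_iff_mem.mpr (Ideal.mem_map_of_mem _ ha)
  let f : X.B →+* X.SymW ⧸ X.J := RingHom.liftOfSurjective X.φ hφ ⟨f₀, hf₀⟩
  have hf : ∀ a, f (X.φ a) = f₀ a := fun a =>
    RingHom.liftOfRightInverse_comp_apply X.φ _ _ ⟨f₀, hf₀⟩ a
  obtain ⟨θ, hθ⟩ := exists_ringHom_lift_pow (k := k) X.J n f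
    ((algebraMap X.A X.SymW).comp (algebraMap k X.A)) (fun r => by
      rw [IsScalarTower.algebraMap_apply k X.A X.B]
      exact (hf _).symm)
  refine ⟨(Ideal.Quotient.factor hH).comp θ, fun a => ?_⟩
  have h := Ideal.mem_map_of_mem (Ideal.Quotient.factor hH) (hθ (X.φ a) _ (hf a))
  rwa [Ideal.map_map, Ideal.Quotient.factor_comp_mk, map_sub, Ideal.Quotient.factor_mk] at h

/-- The additive map `Sym L ⊗ (S^q N ⊗ S^{p-q} K) → Sym W / H` that takes the expected values on
generators. -/
theorem exists_multiplication (k : Type) [CommRing k] [Algebra k X.A] [Algebra k X.B]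
    [IsScalarTower k X.A X.B] [Algebra.FormallySmooth k X.A] [Algebra.FormallySmooth k X.B]
    [Module.Projective X.A X.W] [Module.Projective X.B X.L]
    (hφ : Function.Surjective X.φ) (hε : Function.Surjective X.ε) (p q : ℕ) :
    ∃ τ : X.T p q →+ X.SymW ⧸ nextTerm X.J X.I q (p - q),
      ∀ (a : Fin q → X.ID) (w : Fin (p - q) → LinearMap.ker X.ε) (s : X.SymW),
      τ (tGenerator a w s) = Ideal.Quotient.mk _
        ((∏ j, algebraMap X.A X.SymW (a j)) * (∏ j, ι X.A X.W (w j)) * s) := by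
  have hprojN : Module.Projective X.B X.N := projective_N k hφ
  have hprojK : Module.Projective X.B X.K := projective_K hε
  set H := nextTerm X.J X.I q (p - q) with hHdef
  set mk : X.SymW →+* X.SymW ⧸ H := Ideal.Quotient.mk H
  -- modulo `H`, products that agree up to `nextTerm` are equal
  have hmk : nextTerm (X.J.map mk) (X.I.map mk) q (p - q) = ⊥ := by
    rw [← map_nextTerm]
    exact Ideal.map_quotient_self H
  have hH : X.J ^ (q + (p - q) + 1) ≤ H :=
    (Ideal.pow_right_mono J_le_I _).trans (pow_le_nextTerm _ _ _ _)
  obtain ⟨β, hβ⟩ := exists_section k hφ _ H hH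
  have hnm : X.J.map mk ≤ X.I.map mk := Ideal.map_mono J_le_I
  -- `w ↦ w` is `β`-linear up to the failure of `β (φ a) = a`, which lies in `J`
  have hlinW : ∀ (a : X.A) (w : X.W), mk (ι X.A X.W (a • w)) - β (X.φ a) * mk (ι X.A X.W w) =
      -((β (X.φ a) - mk (algebraMap X.A X.SymW a)) * mk (ι X.A X.W w)) := fun a w => by
    rw [map_smul, Algebra.smul_def, map_mul]
    ring
  obtain ⟨ΨL, hΨL, hΨL'⟩ := exists_symmetricAlgebra_lift_of_surjective X.φ hφ
    (X.ε : X.W →+ X.L) hε (fun a w => X.ε.map_smulₛₗ a w) β (X.I.map mk)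
    ((mk : X.SymW →+ X.SymW ⧸ H).comp (ι X.A X.W).toAddMonoidHom)
    (fun a w => by
      change mk (ι X.A X.W (a • w)) - β (X.φ a) * mk (ι X.A X.W w) ∈ _
      rw [hlinW, neg_mem_iff]
      exact Ideal.mul_mem_right _ _ (hnm (hβ a)))
    (fun w hw => Ideal.mem_map_of_mem mk (kerIdeal_le_I (Ideal.subset_span ⟨⟨w, hw⟩, rfl⟩)))
  obtain ⟨ΨK, hΨK, hΨK'⟩ := exists_symmetricAlgebra_lift_of_surjective (L := X.K) X.φ hφ
    (AddMonoidHom.mk' (toK (X := X)) fun x y =>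
      Subtype.ext (show (1 : X.B) ⊗ₜ[X.A] ((x : X.W) + (y : X.W)) = _ from
        TensorProduct.tmul_add _ _ _))
    (toK_surjective hφ)
    (fun a w => Subtype.ext (by
      change (1 : X.B) ⊗ₜ[X.A] (a • (w : X.W)) = X.φ a • ((1 : X.B) ⊗ₜ[X.A] (w : X.W))
      rw [← TensorProduct.smul_tmul, TensorProduct.smul_tmul']
      congr 1)) β (X.J.map mk)
    (((mk : X.SymW →+ X.SymW ⧸ H).comp (ι X.A X.W).toAddMonoidHom).comp
      (LinearMap.ker X.ε).subtype.toAddMonoidHom)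
    (fun a w => by
      change mk (ι X.A X.W (a • (w : X.W))) - β (X.φ a) * mk (ι X.A X.W w) ∈ _
      rw [hlinW, neg_mem_iff]
      exact Ideal.mul_mem_right _ _ (hβ a))
    (fun w hw => Ideal.mem_map_of_mem mk
      (ι_mem_J_of_one_tmul_eq_zero hφ (congrArg Subtype.val hw)))
  obtain ⟨ΨN, hΨN, hΨN'⟩ := exists_symmetricAlgebra_lift_of_surjective (W := X.ID) X.φ hφ
    (AddMonoidHom.mk' (toN (X := X)) fun x y => by
      rw [toN, map_add, TensorProduct.tmul_add]
      rfl)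
    (toN_surjective hφ)
    (fun a x => by
      change (1 : X.B) ⊗ₜ[X.A] (X.ID.toCotangent (a • x)) =
        X.φ a • ((1 : X.B) ⊗ₜ[X.A] (X.ID.toCotangent x))
      rw [map_smul, ← TensorProduct.smul_tmul, TensorProduct.smul_tmul']
      congr 1) β (X.J.map mk ^ 2)
    (((mk.comp (algebraMap X.A X.SymW) : X.A →+* X.SymW ⧸ H) : X.A →+ X.SymW ⧸ H).comp
      X.ID.subtype.toAddMonoidHom)
    (fun a x => by
      change mk (algebraMap X.A X.SymW (a * (x : X.A))) -
        β (X.φ a) * mk (algebraMap X.A X.SymW x) ∈ _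
      have hx : mk (algebraMap X.A X.SymW x) ∈ X.J.map mk :=
        Ideal.mem_map_of_mem mk (Ideal.mem_map_of_mem (algebraMap X.A X.SymW) x.2)
      have h : _ ∈ X.J.map mk * X.J.map mk := Ideal.mul_mem_mul (hβ a) hx
      rw [← neg_mem_iff, pow_two]
      convert h using 1
      rw [map_mul, map_mul]
      ring)
    (fun x hx => by
      rw [← Ideal.map_pow, J, ← Ideal.map_pow]
      exact Ideal.mem_map_of_mem mk (Ideal.mem_map_of_mem _ (mem_ID_sq_of_toN_eq_zero hφ hx)))
  have hΨLs : ∀ s, ΨL (X.symε s) - mk s ∈ X.I.map mk := by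
    refine symmetricAlgebra_sub_mem (ΨL.comp X.symε) mk _ (fun a => ?_) (fun w => ?_)
    · change ΨL (symMap X.φ X.ε _) - _ ∈ _
      rw [symMap_algebraMap, hΨL]
      exact hnm (hβ a)
    · change ΨL (symMap X.φ X.ε _) - _ ∈ _
      rw [symMap_ι]
      exact hΨL' w
  obtain ⟨τ, hτ⟩ := exists_tensor_mul (K := X.K) β ΨL ΨN ΨK hΨL hΨN hΨK q (p - q)
  refine ⟨τ, fun a w s => ?_⟩
  have key := prod_mul_prod_mul_sub_mem hnm (q := q) (r := p - q)
    (x := fun j => ΨN (ι X.B X.N (toN (a j))))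
    (x' := fun j => mk (algebraMap X.A X.SymW (a j)))
    (y := fun j => ΨK (ι X.B X.K (toK (w j))))
    (y' := fun j => mk (ι X.A X.W (w j)))
    (z := ΨL (X.symε s)) (z' := mk s)
    (fun j => hΨN' (a j))
    (fun j => Ideal.mem_map_of_mem mk (Ideal.mem_map_of_mem _ (a j).2))
    (fun j => hΨK' (w j))
    (fun j => Ideal.mem_map_of_mem mk (kerIdeal_le_I (Ideal.subset_span ⟨w j, rfl⟩))) (hΨLs s)
  rw [hmk, Ideal.mem_bot, sub_eq_zero] at key
  rw [tGenerator, hτ, mul_comm]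
  refine Eq.trans ?_ (key.trans ?_)
  · rw [← map_prod ΨN, ← map_prod ΨK]
    rfl
  · rw [map_mul mk, map_mul mk, map_prod mk, map_prod mk]

/-- The canonical isomorphism over one chart. -/
theorem exists_iso (k : Type) [CommRing k] [Algebra k X.A] [Algebra k X.B]
    [IsScalarTower k X.A X.B] [Algebra.FormallySmooth k X.A] [Algebra.FormallySmooth k X.B]
    [Module.Projective X.A X.W] [Module.Projective X.B X.L]
    (hφ : Function.Surjective X.φ) (hε : Function.Surjective X.ε) {p q : ℕ} (hq : q ≤ p) :
    ∃ Φ : X.T p q ≃+ X.Gr p q, ∀ a w s, Φ (tGenerator a w s) = grGenerator hq a w s := by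
  obtain ⟨g, hg, hg'⟩ := exists_leadingTerm k hφ hε p q
  obtain ⟨τ, hτ⟩ := exists_multiplication k hφ hε p q
  exact exists_iso_of_maps hq hφ hε g hg hg' τ hτ

end BundleChart

/-! ### Localization of sections over affine opens -/

namespace AlgebraicGeometry

/-- The basic open of `Spec R` defined by `f`, as an open of the scheme `Spec R`. -/
def specBasicOpen {R : CommRingCat.{0}} (f : R) : (Spec R).Opens := PrimeSpectrum.basicOpen f

/-- The localization property of a sheaf of modules on `Spec R` in terms of sections. -/
theorem isLocalizing_iff_exists {R : CommRingCat.{0}} (N : (Spec R).Modules) :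
    IsLocalizing (modulesSpecToSheaf.obj N) ↔
      (∀ (f : R) (s : Γ(N, specBasicOpen f)), ∃ (n : ℕ) (t : Γ(N, ⊤)),
        N.presheaf.map (homOfLE le_top).op t = f ^ n • s) ∧
      ∀ (f : R) (t : Γ(N, ⊤)), N.presheaf.map (homOfLE le_top).op t =
        (0 : Γ(N, specBasicOpen f)) → ∃ n : ℕ, f ^ n • t = 0 := by
  let φ (f : R) := ((modulesSpecToSheaf.obj N).obj.map (PrimeSpectrum.basicOpen f).leTop.op).hom
  refine ⟨fun h => ?_, fun h f => IsLocalizedModule.Away.mk_of_addCommGroup ?_ ?_ ?_⟩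
  · have hf (f : R) : IsLocalizedModule.Away f (φ f) := h f
    refine ⟨fun f s => ?_, fun f s hs => ?_⟩
    · obtain ⟨n, y, hy⟩ := (hf f).surj _ _ s
      exact ⟨n, y, hy.symm⟩
    · obtain ⟨⟨_, n, rfl⟩, hn⟩ := (IsLocalizedModule.eq_zero_iff (.powers f) (φ f)).mp hs
      exact ⟨n, hn⟩
  · exact N.isUnit_algebraMap_end_of_le_basicOpen f le_rfl
  · intro x
    obtain ⟨n, t, ht⟩ := h.1 f x
    exact ⟨n, t, ht.symm⟩
  · intro x hx
    obtain ⟨n, hn⟩ := h.2 f x hx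
    exact ⟨n, hn⟩

namespace IsAffineOpen

variable {X : Scheme.{0}} {U : X.Opens} (hU : IsAffineOpen U)

theorem fromSpec_image_top' : hU.fromSpec ''ᵁ ⊤ = U := by
  rw [Scheme.Hom.image_top_eq_opensRange, opensRange_fromSpec]

theorem fromSpec_image_le (V : (Spec Γ(X, U)).Opens) : hU.fromSpec ''ᵁ V ≤ U :=
  (hU.fromSpec.image_mono le_top).trans hU.fromSpec_image_top'.le

/-- The action of `Γ(X, U)` on the sections over an open of `Spec Γ(X, U)` is given by restriction
of functions on `X`. -/
theorem ΓSpecIso_inv_map_appIso_inv (V : (Spec Γ(X, U)).Opens) :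
    (Scheme.ΓSpecIso Γ(X, U)).inv ≫ (Spec Γ(X, U)).presheaf.map V.leTop.op ≫
      (hU.fromSpec.appIso V).inv = X.presheaf.map (homOfLE (hU.fromSpec_image_le V)).op := by
  have e : V ≤ hU.fromSpec ⁻¹ᵁ U := by
    rw [hU.fromSpec_preimage_self]
    exact le_top
  rw [← Scheme.Hom.appLE_appIso_inv hU.fromSpec e, Scheme.Hom.appLE, hU.fromSpec_app_self,
    Category.assoc, Category.assoc, ← Functor.map_comp_assoc]
  rfl

theorem restrictAppIso_hom_smul (E : X.Modules) (V : (Spec Γ(X, U)).Opens) (r : Γ(X, U))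
    (x : Γ(E.restrict hU.fromSpec, V)) :
    (E.restrictAppIso hU.fromSpec V).hom (r • x) =
      X.presheaf.map (homOfLE (hU.fromSpec_image_le V)).op r •
        (E.restrictAppIso hU.fromSpec V).hom x := by
  rw [Scheme.Modules.smul_Spec_def, Scheme.Modules.smul_restrictAppIso_hom_apply,
    ← ΓSpecIso_inv_map_appIso_inv]
  rfl

/-- The restriction map from the sections of `E.restrict hU.fromSpec` over `V` to the sections of `E`
over an open contained in the image of `V`. -/
def resSpec (E : X.Modules) (V : (Spec Γ(X, U)).Opens) (V' : X.Opens)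
    (h : V' ≤ hU.fromSpec ''ᵁ V) : Γ(E.restrict hU.fromSpec, V) →+ Γ(E, V') :=
  ((E.restrictAppIso hU.fromSpec V).hom ≫ E.presheaf.map (homOfLE h).op).hom

theorem resSpec_smul (E : X.Modules) (V : (Spec Γ(X, U)).Opens) (V' : X.Opens)
    (h : V' ≤ hU.fromSpec ''ᵁ V) (r : Γ(X, U)) (x : Γ(E.restrict hU.fromSpec, V)) :
    hU.resSpec E V V' h (r • x) =
      X.presheaf.map (homOfLE (h.trans (hU.fromSpec_image_le V))).op r • hU.resSpec E V V' h x := by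
  change E.presheaf.map (homOfLE h).op ((E.restrictAppIso hU.fromSpec V).hom (r • x)) = _
  rw [restrictAppIso_hom_smul, Scheme.Modules.map_smul, ← ConcreteCategory.comp_apply,
    ← Functor.map_comp]
  rfl

theorem resSpec_map (E : X.Modules) {V₁ V₂ : (Spec Γ(X, U)).Opens} (i : V₂ ≤ V₁)
    {V₁' V₂' : X.Opens} (i' : V₂' ≤ V₁') (h₁ : V₁' ≤ hU.fromSpec ''ᵁ V₁)
    (h₂ : V₂' ≤ hU.fromSpec ''ᵁ V₂) (x : Γ(E.restrict hU.fromSpec, V₁)) :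
    hU.resSpec E V₂ V₂' h₂ ((E.restrict hU.fromSpec).presheaf.map (homOfLE i).op x) =
      E.presheaf.map (homOfLE i').op (hU.resSpec E V₁ V₁' h₁ x) := by
  have h : (E.restrict hU.fromSpec).presheaf.map (homOfLE i).op ≫
      (E.restrictAppIso hU.fromSpec V₂).hom ≫ E.presheaf.map (homOfLE h₂).op =
      ((E.restrictAppIso hU.fromSpec V₁).hom ≫ E.presheaf.map (homOfLE h₁).op) ≫
        E.presheaf.map (homOfLE i').op := by
    rw [Scheme.Modules.map_restrictAppIso_hom_assoc, Category.assoc, ← Functor.map_comp,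
      ← Functor.map_comp]
    rfl
  exact ConcreteCategory.congr_hom h x

theorem bijective_resSpec (E : X.Modules) (V : (Spec Γ(X, U)).Opens) (V' : X.Opens)
    (h : V' = hU.fromSpec ''ᵁ V) : Function.Bijective (hU.resSpec E V V' h.le) := by
  subst h
  have e : hU.resSpec E V _ le_rfl = (E.restrictAppIso hU.fromSpec V).hom.hom := by
    have h2 : E.presheaf.map (homOfLE (le_refl (hU.fromSpec ''ᵁ V))).op = 𝟙 _ :=
      E.presheaf.map_id _
    rw [resSpec, h2, Category.comp_id]
  rw [e]
  exact ConcreteCategory.bijective_of_isIso (E.restrictAppIso hU.fromSpec V).hom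

end IsAffineOpen

/-- The sections of `E` over the basic opens of `U` are the localizations of those over `U`. This is
stated elementwise; that `f` is invertible on the sections over its basic open is automatic. -/
structure Scheme.Modules.IsLocalizingOn {X : Scheme.{0}} (E : X.Modules) (U : X.Opens) : Prop where
  exists_map_eq_pow_smul (f : Γ(X, U)) (s : Γ(E, X.basicOpen f)) :
    ∃ (n : ℕ) (t : Γ(E, U)), E.presheaf.map (homOfLE (X.basicOpen_le f)).op t =
      X.presheaf.map (homOfLE (X.basicOpen_le f)).op f ^ n • s
  exists_pow_smul_eq_zero (f : Γ(X, U)) (t : Γ(E, U))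
    (ht : E.presheaf.map (homOfLE (X.basicOpen_le f)).op t = 0) : ∃ n : ℕ, f ^ n • t = 0

namespace IsAffineOpen

variable {X : Scheme.{0}} {U : X.Opens} (hU : IsAffineOpen U)

theorem resSpec_smul_self (E : X.Modules) (r : Γ(X, U)) (x : Γ(E.restrict hU.fromSpec, ⊤)) :
    hU.resSpec E ⊤ U hU.fromSpec_image_top'.ge (r • x) =
      r • hU.resSpec E ⊤ U hU.fromSpec_image_top'.ge x := by
  rw [hU.resSpec_smul]
  have e : X.presheaf.map (homOfLE (le_refl U)).op r = r :=
    ConcreteCategory.congr_hom (X.presheaf.map_id _) _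
  rw [e]

theorem isLocalizing_restrict_iff (E : X.Modules) :
    IsLocalizing (modulesSpecToSheaf.obj (E.restrict hU.fromSpec)) ↔ E.IsLocalizingOn U := by
  have hres (f : Γ(X, U)) (t : Γ(E.restrict hU.fromSpec, ⊤)) :
      hU.resSpec E (specBasicOpen f) _ (hU.fromSpec_image_basicOpen f).ge
        ((E.restrict hU.fromSpec).presheaf.map (homOfLE le_top).op t) =
      E.presheaf.map (homOfLE (X.basicOpen_le f)).op
        (hU.resSpec E ⊤ U hU.fromSpec_image_top'.ge t) :=
    hU.resSpec_map E le_top (X.basicOpen_le f) hU.fromSpec_image_top'.ge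
      (hU.fromSpec_image_basicOpen f).ge t
  have htop := hU.bijective_resSpec E ⊤ _ hU.fromSpec_image_top'.symm
  have hbas (f : Γ(X, U)) := hU.bijective_resSpec E (specBasicOpen f) _
    (hU.fromSpec_image_basicOpen f).symm
  rw [isLocalizing_iff_exists]
  refine ⟨fun ⟨h1, h2⟩ => ⟨fun f s => ?_, fun f t ht => ?_⟩,
    fun h => ⟨fun f s => ?_, fun f t ht => ?_⟩⟩
  · obtain ⟨s', rfl⟩ := (hbas f).2 s
    obtain ⟨n, t, ht⟩ := h1 f s'
    refine ⟨n, hU.resSpec E ⊤ U hU.fromSpec_image_top'.ge t, ?_⟩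
    rw [← hres, ← map_pow, ← hU.resSpec_smul, ht]
  · obtain ⟨t, rfl⟩ := htop.2 t
    rw [← hres] at ht
    obtain ⟨n, hn⟩ := h2 f t ((hbas f).1 (ht.trans (map_zero _).symm))
    refine ⟨n, ?_⟩
    have h := congrArg (hU.resSpec E ⊤ U hU.fromSpec_image_top'.ge) hn
    rwa [map_zero, hU.resSpec_smul_self] at h
  · obtain ⟨n, t, ht⟩ := h.exists_map_eq_pow_smul f (hU.resSpec E (specBasicOpen f) _
      (hU.fromSpec_image_basicOpen f).ge s)
    obtain ⟨t, rfl⟩ := htop.2 t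
    refine ⟨n, t, (hbas f).1 ?_⟩
    rw [hres, ht, hU.resSpec_smul, map_pow]
  · obtain ⟨n, hn⟩ := h.exists_pow_smul_eq_zero f (hU.resSpec E ⊤ U hU.fromSpec_image_top'.ge t)
      (by rw [← hres, ht, map_zero])
    refine ⟨n, htop.1 ?_⟩
    rw [hU.resSpec_smul_self, hn, map_zero]

/-- A sheaf of modules is the one associated with its module of sections on `U` if and only if its
sections localize over `U`. -/
theorem isIso_fromTildeΓ_restrict_iff (E : X.Modules) :
    IsIso (E.restrict hU.fromSpec).fromTildeΓ ↔ E.IsLocalizingOn U := by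
  rw [isIso_fromTildeΓ_iff_isLocalizing, isLocalizing_restrict_iff]

/-- The sections of a quasi-coherent sheaf localize over every affine open. -/
theorem isLocalizingOn {X : Scheme.{0}} {U : X.Opens} (hU : IsAffineOpen U) (E : X.Modules)
    [E.IsQuasicoherent] : E.IsLocalizingOn U := by
  rw [← hU.isIso_fromTildeΓ_restrict_iff]
  infer_instance

end IsAffineOpen

/-- The localization property passes to direct images, as preimages of basic opens are basic
opens. This replaces the quasi-coherence of the direct image. -/
theorem Scheme.Modules.IsLocalizingOn.pushforward {X Y : Scheme.{0}} (i : X ⟶ Y) {E : X.Modules}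
    {U : Y.Opens} (h : E.IsLocalizingOn (i ⁻¹ᵁ U)) :
    ((Scheme.Modules.pushforward i).obj E).IsLocalizingOn U where
  exists_map_eq_pow_smul f s := by
    have key : ∀ (V : X.Opens) (hV : V = X.basicOpen (i.app U f)) (hVU : V ≤ i ⁻¹ᵁ U)
        (s : Γ(E, V)), ∃ (n : ℕ) (t : Γ(E, i ⁻¹ᵁ U)), E.presheaf.map (homOfLE hVU).op t =
          X.presheaf.map (homOfLE hVU).op (i.app U f) ^ n • s := by
      rintro V rfl hVU s
      exact h.exists_map_eq_pow_smul (i.app U f) s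
    obtain ⟨n, t, ht⟩ := key (i ⁻¹ᵁ Y.basicOpen f) (Scheme.preimage_basicOpen i f)
      (fun x hx => Y.basicOpen_le f hx) s
    refine ⟨n, t, ht.trans ?_⟩
    rw [← map_pow]
    have e := ConcreteCategory.congr_hom (i.naturality (homOfLE (Y.basicOpen_le f)).op) (f ^ n)
    have e2 : X.presheaf.map (homOfLE fun x hx => Y.basicOpen_le f hx).op (i.app U (f ^ n)) =
      i.app _ (Y.presheaf.map (homOfLE (Y.basicOpen_le f)).op (f ^ n)) := e.symm
    rw [← map_pow, ← map_pow, e2]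
    rfl
  exists_pow_smul_eq_zero f t ht := by
    have key : ∀ (V : X.Opens) (hV : V = X.basicOpen (i.app U f)) (hVU : V ≤ i ⁻¹ᵁ U)
        (t : Γ(E, i ⁻¹ᵁ U)), E.presheaf.map (homOfLE hVU).op t = 0 →
          ∃ n : ℕ, i.app U f ^ n • t = 0 := by
      rintro V rfl hVU t ht
      exact h.exists_pow_smul_eq_zero (i.app U f) t ht
    obtain ⟨n, hn⟩ := key (i ⁻¹ᵁ Y.basicOpen f) (Scheme.preimage_basicOpen i f)
      (fun x hx => Y.basicOpen_le f hx) t ht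
    refine ⟨n, ?_⟩
    rw [← map_pow] at hn
    exact hn

theorem epi_of_comp_eq_comp {C : Type*} [Category C] {a b c d : C} {f : a ⟶ b} {β : b ⟶ d}
    {α : a ⟶ c} {g : c ⟶ d} (h : f ≫ β = α ≫ g) (hα : IsIso α) (hβ : IsIso β) (hg : Epi g) :
    Epi f := by
  rw [(IsIso.eq_comp_inv β).mpr h]
  infer_instance

/-- An epimorphism between sheaves associated with modules is surjective on global sections:
`tilde` is faithful, hence reflects epimorphisms. -/
theorem surjective_app_top {R : CommRingCat.{0}} {E F : (Spec R).Modules} (g : E ⟶ F) [Epi g]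
    (hE : IsIso E.fromTildeΓ) (hF : IsIso F.fromTildeΓ) : Function.Surjective (g.app ⊤) := by
  have hepi : Epi ((tilde.functor _).map (moduleSpecΓFunctor.map g)) :=
    epi_of_comp_eq_comp (Scheme.Modules.fromTildeΓNatTrans.naturality g) hE hF ‹Epi g›
  have hsurj := (ModuleCat.epi_iff_surjective _).mp ((tilde.functor _).epi_of_epi_map hepi)
  exact hsurj

/-- An epimorphism of sheaves of modules whose sections localize over an affine open is surjective on
the sections over this open. -/
theorem IsAffineOpen.surjective_app {X : Scheme.{0}} {U : X.Opens} (hU : IsAffineOpen U)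
    {E F : X.Modules} (g : E ⟶ F) [Epi g] (hE : E.IsLocalizingOn U) (hF : F.IsLocalizingOn U) :
    Function.Surjective (g.app U) := by
  rw [← hU.isIso_fromTildeΓ_restrict_iff] at hE hF
  have hsurj : Function.Surjective (g.app (hU.fromSpec ''ᵁ ⊤)) :=
    surjective_app_top ((Scheme.Modules.restrictFunctor hU.fromSpec).map g) hE hF
  rwa [hU.fromSpec_image_top'] at hsurj

end AlgebraicGeometry

/-! ### Vector bundles over affine opens -/

/-- A module that becomes finite projective over a cover by basic opens is projective: it is
finitely presented and flat. -/
theorem Module.Projective.of_isLocalizedModule_span {R P : Type} [CommRing R] [AddCommGroup P]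
    [Module R P] (s : Set R) (hs : Ideal.span s = ⊤) (R' P' : s → Type) [∀ g, CommRing (R' g)]
    [∀ g, Algebra R (R' g)] [∀ g : s, IsLocalization.Away g.1 (R' g)] [∀ g, AddCommGroup (P' g)]
    [∀ g, Module R (P' g)] [∀ g, Module (R' g) (P' g)] [∀ g, IsScalarTower R (R' g) (P' g)]
    (φ : ∀ g, P →ₗ[R] P' g) [∀ g : s, IsLocalizedModule (Submonoid.powers g.1) (φ g)]
    [∀ g, Module.Projective (R' g) (P' g)] [∀ g, Module.Finite (R' g) (P' g)] :
    Module.Projective R P := by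
  have h1 : Module.FinitePresentation R P :=
    Module.FinitePresentation.of_localizationSpan' (Rₚ := R') s hs φ fun g =>
      Module.finitePresentation_of_projective (R' g) (P' g)
  have h2 : Module.Flat R P :=
      Module.flat_of_isLocalized_span (S := R) (M := P) s hs P' φ fun g => by
    have := IsLocalization.flat (R' g) (Submonoid.powers g.1)
    exact Module.Flat.trans R (R' g) (P' g)
  exact Module.Flat.projective_of_finitePresentation

namespace AlgebraicGeometry

variable {X : Scheme.{0}}

theorem isQuasicoherent_of_isVectorBundle {E : X.Modules} (hE : IsVectorBundle E) :
    E.IsQuasicoherent := by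
  obtain ⟨q, hq, _⟩ := hE
  exact q.quasiCoherentData.isQuasicoherent

/-- Around each point, a vector bundle is free on all small affine opens. -/
theorem exists_restrict_iso_free {E : X.Modules} (hE : IsVectorBundle E) (x : X) :
    ∃ V : X.Opens, x ∈ V ∧ ∀ (V' : X.Opens) (hV' : IsAffineOpen V'), V' ≤ V →
      ∃ (I : Type) (_ : Finite I), Nonempty (E.restrict hV'.fromSpec ≅ SheafOfModules.free I) := by
  obtain ⟨q, hq, hf⟩ := hE
  have hcov := q.coversTop
  rw [Opens.coversTop_iff, TopologicalSpace.IsOpenCover] at hcov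
  obtain ⟨j, hj⟩ := TopologicalSpace.Opens.mem_iSup.mp (hcov ▸ TopologicalSpace.Opens.mem_top x)
  refine ⟨q.X j, hj, fun V' hV' hle => ?_⟩
  have hfin := hf.isFiniteType j
  let u : Spec Γ(X, V') ⟶ (q.X j : Scheme) := hV'.isoSpec.inv ≫ X.homOfLE hle
  have : Limits.PreservesColimitsOfSize.{0, 0} (Scheme.Modules.restrictFunctor u) := inferInstance
  -- restriction to `Spec Γ(X, V')` factors through restriction to the open `q.X j`; it preserves
  -- colimits, hence carries the given free presentation over `q.X j` to one over `V'`
  let F := (Scheme.Modules.overEquiv (q.X j)).functor ⋙ Scheme.Modules.restrictFunctor u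
  let iso : SheafOfModules.overFunctor X.ringCatSheaf _ ⋙ F ≅
      Scheme.Modules.restrictFunctor hV'.fromSpec :=
    (Functor.associator _ _ _).symm ≪≫
      Functor.isoWhiskerRight (Scheme.Modules.overFunctorEquiv _) _ ≪≫
      (Scheme.Modules.restrictFunctorComp _ _).symm ≪≫
      (Scheme.Modules.restrictFunctorCongr (by
        rw [Category.assoc, Scheme.homOfLE_ι, hV'.isoSpec_inv_ι]))
  let F' : SheafOfModules.{0} (X.ringCatSheaf.over (q.X j)) ⥤
      SheafOfModules.{0} (Spec Γ(X, V')).ringCatSheaf := F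
  have hF : Limits.PreservesColimitsOfSize.{0, 0} F' :=
    Limits.comp_preservesColimits (Scheme.Modules.overEquiv (q.X j)).functor
      (Scheme.Modules.restrictFunctor u)
  let G := (q.generators j).map F' (Scheme.Modules.restrictUnitIso _).symm
  have hG : Finite G.I := hfin.finite
  have hπ : IsIso (q.generators j).π := hq.isIso j
  have hGπ : IsIso G.π := by
    have h : G.π = _ := SheafOfModules.GeneratingSections.map_π_eq _ _ _
    rw [h]
    have h2 : IsIso (F'.map (q.generators j).π) := inferInstance
    exact IsIso.comp_isIso' (Iso.isIso_hom _) h2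
  exact ⟨G.I, hG, ⟨(asIso G.π ≪≫ iso.app E).symm⟩⟩

/-- The global sections of a sheaf isomorphic to a finite free one form a finite free module. -/
theorem free_and_finite_of_iso {R : CommRingCat.{0}} {N : (Spec R).Modules} {I : Type} [Finite I]
    (e : N ≅ SheafOfModules.free I) : Module.Free R Γ(N, ⊤) ∧ Module.Finite R Γ(N, ⊤) := by
  let e₁ : N ≅ tilde (ModuleCat.of R (I →₀ R)) := e ≪≫ (tildeFinsupp I).symm
  let e₂ : moduleSpecΓFunctor.obj N ≅ ModuleCat.of R (I →₀ R) :=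
    moduleSpecΓFunctor.mapIso e₁ ≪≫ (tilde.isoTop _).symm
  let e₃ : Γ(N, ⊤) ≃ₗ[R] (I →₀ R) := e₂.toLinearEquiv
  exact ⟨Module.Free.of_equiv e₃.symm, Module.Finite.equiv e₃.symm⟩

theorem IsAffineOpen.free_and_finite {E : X.Modules} {U : X.Opens} (hU : IsAffineOpen U) {I : Type}
    [Finite I] (e : E.restrict hU.fromSpec ≅ SheafOfModules.free I) :
    Module.Free Γ(X, U) Γ(E, U) ∧ Module.Finite Γ(X, U) Γ(E, U) := by
  obtain ⟨h1, h2⟩ := free_and_finite_of_iso e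
  let e' : Γ(E.restrict hU.fromSpec, ⊤) ≃ₗ[Γ(X, U)] Γ(E, U) :=
    LinearEquiv.ofBijective
      { toFun := hU.resSpec E ⊤ U hU.fromSpec_image_top'.ge
        map_add' := map_add _
        map_smul' := hU.resSpec_smul_self E }
      (hU.bijective_resSpec E ⊤ _ hU.fromSpec_image_top'.symm)
  exact ⟨Module.Free.of_equiv e', Module.Finite.equiv e'⟩

/-- The sections of a vector bundle over an affine open form a projective module. -/
theorem IsAffineOpen.projective_of_isVectorBundle {E : X.Modules} (hE : IsVectorBundle E)
    {U : X.Opens} (hU : IsAffineOpen U) : Module.Projective Γ(X, U) Γ(E, U) := by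
  have := isQuasicoherent_of_isVectorBundle hE
  have hloc := hU.isLocalizingOn E
  -- the functions on whose basic opens the bundle is free generate the unit ideal
  let s : Set Γ(X, U) := {f | Module.Free Γ(X, X.basicOpen f) Γ(E, X.basicOpen f) ∧
    Module.Finite Γ(X, X.basicOpen f) Γ(E, X.basicOpen f)}
  have hs : Ideal.span s = ⊤ := by
    rw [← hU.iSup_basicOpen_eq_self_iff]
    refine le_antisymm (iSup_le fun f => X.basicOpen_le _) fun x hx => ?_
    obtain ⟨V, hxV, hV⟩ := exists_restrict_iso_free hE x
    obtain ⟨f, hfV, hxf⟩ := hU.exists_basicOpen_le ⟨x, hxV⟩ hx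
    obtain ⟨I, _, ⟨e⟩⟩ := hV _ (hU.basicOpen f) hfV
    exact TopologicalSpace.Opens.mem_iSup.mpr
      ⟨⟨f, (hU.basicOpen f).free_and_finite e⟩, hxf⟩
  have hR : ∀ f : s, IsLocalization.Away f.1 Γ(X, X.basicOpen f.1) := fun f =>
    hU.isLocalization_basicOpen f.1
  let _ : ∀ f : s, Module Γ(X, U) Γ(E, X.basicOpen f.1) := fun f =>
    Module.compHom _ (algebraMap Γ(X, U) Γ(X, X.basicOpen f.1))
  have hsmul : ∀ (f : s) (r : Γ(X, U)) (x : Γ(E, X.basicOpen f.1)),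
    r • x = algebraMap Γ(X, U) Γ(X, X.basicOpen f.1) r • x := fun f r x => rfl
  have htower : ∀ f : s, IsScalarTower Γ(X, U) Γ(X, X.basicOpen f.1) Γ(E, X.basicOpen f.1) :=
    fun f => IsScalarTower.of_algebraMap_smul fun r x => rfl
  let φ : ∀ f : s, Γ(E, U) →ₗ[Γ(X, U)] Γ(E, X.basicOpen f.1) := fun f =>
    { toFun := fun x => E.presheaf.map (homOfLE (X.basicOpen_le f.1)).op x
      map_add' := fun x y => map_add (E.presheaf.map (homOfLE (X.basicOpen_le f.1)).op).hom x y
      map_smul' := fun r x => E.map_smul (homOfLE (X.basicOpen_le f.1)) r x }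
  have hφ : ∀ f : s, IsLocalizedModule (Submonoid.powers f.1) (φ f) := fun f => by
    refine IsLocalizedModule.Away.mk_of_addCommGroup ?_ ?_ ?_
    · have h1 := (IsLocalization.Away.algebraMap_isUnit (S := Γ(X, X.basicOpen f.1)) f.1).map
        (algebraMap _ (Module.End Γ(X, X.basicOpen f.1) Γ(E, X.basicOpen f.1)))
      rw [Module.End.isUnit_iff] at h1 ⊢
      exact h1
    · intro x
      obtain ⟨n, t, ht⟩ := hloc.exists_map_eq_pow_smul f.1 x
      refine ⟨n, t, ?_⟩
      rw [hsmul, map_pow]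
      exact ht.symm
    · intro x hx
      exact hloc.exists_pow_smul_eq_zero f.1 x hx
  have h1 : ∀ f : s, Module.Projective Γ(X, X.basicOpen f.1) Γ(E, X.basicOpen f.1) := fun f => by
    have := f.2.1
    infer_instance
  have h2 : ∀ f : s, Module.Finite Γ(X, X.basicOpen f.1) Γ(E, X.basicOpen f.1) := fun f => f.2.2
  exact Module.Projective.of_isLocalizedModule_span s hs (fun f => Γ(X, X.basicOpen f.1))
    (fun f => Γ(E, X.basicOpen f.1)) φ

end AlgebraicGeometry

/-! ### The charts of a pair of smooth schemes -/

namespace AlgebraicGeometry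

theorem Scheme.Hom.appLE_formallySmooth {X S : Scheme.{0}} (f : X ⟶ S) [Smooth f]
    {U : S.Opens} {V : X.Opens} (hU : IsAffineOpen U) (hV : IsAffineOpen V) (e : V ≤ f ⁻¹ᵁ U) :
    (f.appLE U V e).hom.FormallySmooth :=
  (f.smooth_appLE hU hV e).formallySmooth

theorem Scheme.Hom.comp_appLE_top_preimage {X Y Z : Scheme.{0}} (f : X ⟶ Y) (g : Y ⟶ Z)
    (U : Y.Opens) :
    (f ≫ g).appLE ⊤ (f ⁻¹ᵁ U) le_top = g.appLE ⊤ U le_top ≫ f.app U := by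
  rw [Scheme.Hom.app_eq_appLE]
  exact (Scheme.Hom.appLE_comp_appLE f g ⊤ U (f ⁻¹ᵁ U) le_top le_rfl).symm

end AlgebraicGeometry

theorem bundleChart_φ_surjective {M D : Scheme.{0}} (i : D ⟶ M) [IsClosedImmersion i]
    (W : M.Modules) (L : D.Modules) (ε : W ⟶ (Scheme.Modules.pushforward i).obj L)
    (U : M.affineOpens) :
    Function.Surjective (bundleChart i W L ε U).φ :=
  i.app_surjective U U.2

/-- Epimorphisms of sheaves are only locally surjective on sections; over affine opens,
quasi-coherence makes `W(U) → L(D ∩ U)` surjective. -/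
theorem bundleChart_ε_surjective {M D : Scheme.{0}} (i : D ⟶ M) [IsClosedImmersion i]
    {W : M.Modules} (hW : IsVectorBundle W) {L : D.Modules} (hL : IsVectorBundle L)
    (ε : W ⟶ (Scheme.Modules.pushforward i).obj L) [Epi ε] (U : M.affineOpens) :
    Function.Surjective (bundleChart i W L ε U).ε := by
  have := isQuasicoherent_of_isVectorBundle hW
  have := isQuasicoherent_of_isVectorBundle hL
  exact U.2.surjective_app ε (U.2.isLocalizingOn W)
    (((U.2.preimage i).isLocalizingOn L).pushforward i)

/-- The canonical isomorphism over an affine open, for `M` and `D` smooth over an affine base; the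
ring of functions on the base serves as the ground ring for formal smoothness. -/
theorem bundleChart_exists_iso {M D S : Scheme.{0}} [IsAffine S] (sM : M ⟶ S) [Smooth sM]
    (i : D ⟶ M) [IsClosedImmersion i] [Smooth (i ≫ sM)] {W : M.Modules} (hW : IsVectorBundle W)
    {L : D.Modules} (hL : IsVectorBundle L) (ε : W ⟶ (Scheme.Modules.pushforward i).obj L) [Epi ε]
    (U : M.affineOpens) {p q : ℕ} (hq : q ≤ p) :
    ∃ Φ : (bundleChart i W L ε U).T p q ≃+ (bundleChart i W L ε U).Gr p q,
      ∀ a w s, Φ (BundleChart.tGenerator a w s) = BundleChart.grGenerator hq a w s := by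
  set X := bundleChart i W L ε U
  let U' : D.Opens := i ⁻¹ᵁ U
  have hU' : IsAffineOpen U' := U.2.preimage i
  let f : Γ(S, ⊤) →+* X.A := (sM.appLE ⊤ U le_top).hom
  let g : Γ(S, ⊤) →+* X.B := ((i ≫ sM).appLE ⊤ U' le_top).hom
  let : Algebra Γ(S, ⊤) X.A := f.toAlgebra
  let : Algebra Γ(S, ⊤) X.B := g.toAlgebra
  have : IsScalarTower Γ(S, ⊤) X.A X.B :=
    IsScalarTower.of_algebraMap_eq fun x => DFunLike.congr_fun
      (congrArg CommRingCat.Hom.hom (Scheme.Hom.comp_appLE_top_preimage i sM U)) x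
  have : Algebra.FormallySmooth Γ(S, ⊤) X.A :=
    sM.appLE_formallySmooth (isAffineOpen_top S) U.2 le_top
  have : Algebra.FormallySmooth Γ(S, ⊤) X.B :=
    (i ≫ sM).appLE_formallySmooth (isAffineOpen_top S) hU' le_top
  have : Module.Projective X.A X.W := U.2.projective_of_isVectorBundle hW
  have : Module.Projective X.B X.L := hU'.projective_of_isVectorBundle hL
  exact BundleChart.exists_iso Γ(S, ⊤) (bundleChart_φ_surjective i W L ε U)
    (bundleChart_ε_surjective i hW hL ε U) hq

theorem proposition4p2 (M D : Scheme.{0}) (sM : M ⟶ Spec (CommRingCat.of ℂ)) [Smooth sM]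
    (i : D ⟶ M) [IsClosedImmersion i] [Smooth (i ≫ sM)]
    (W : M.Modules) (hW : IsVectorBundle W) (L : D.Modules) (hL : IsVectorBundle L)
    (ε : W ⟶ (Scheme.Modules.pushforward i).obj L) [Epi ε] (p : ℕ) :
    -- `Sym W → Sym L` is surjective over affine opens
    (∀ U : M.affineOpens, Function.Surjective (bundleChart i W L ε U).symε) ∧
    -- `F^•` is a finite decreasing filtration of `I^p / I^{p+1}` by graded submodules
    (∀ U : M.affineOpens,
      (bundleChart i W L ε U).F p 0 = ⊤ ∧
      Antitone ((bundleChart i W L ε U).F p) ∧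
      (∀ q, p < q → (bundleChart i W L ε U).F p q = ⊥) ∧
      (∀ q, ∀ x ∈ (bundleChart i W L ε U).F p q,
        x ∈ AddSubgroup.closure {y | y ∈ (bundleChart i W L ε U).F p q ∧
          ∃ d, y ∈ (bundleChart i W L ε U).QDeg p d})) ∧
    -- `gr_q` is `0` for `q > p`
    (∀ q, p < q → ∀ U : M.affineOpens, Subsingleton ((bundleChart i W L ε U).Gr p q)) ∧
    -- the isomorphism of sheaves of graded `Sym L`-modules, for `q ≤ p`
    (∀ q, ∀ hq : q ≤ p,
      ∃ Φ : ∀ U : M.affineOpens,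
          (bundleChart i W L ε U).T p q ≃+ (bundleChart i W L ε U).Gr p q,
        -- compatibility with restriction to smaller affine opens
        (∀ (U V : M.affineOpens) (h : (V : M.Opens) ≤ U)
            (x : (bundleChart i W L ε U).T p q),
          Φ V ((bundleRes i W L ε h).resT p q x) = (bundleRes i W L ε h).resGr p q (Φ U x)) ∧
        -- linearity over `Sym W`, that is, over its quotient `Sym L`
        (∀ (U : M.affineOpens) (s : (bundleChart i W L ε U).SymW)
            (x : (bundleChart i W L ε U).T p q),
          Φ U ((bundleChart i W L ε U).symε s • x) = s • Φ U x) ∧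
        -- compatibility with the gradings
        (∀ (U : M.affineOpens) (d : ℕ) (x : (bundleChart i W L ε U).T p q),
          x ∈ (bundleChart i W L ε U).TDeg p q d ↔ Φ U x ∈ (bundleChart i W L ε U).GrDeg p q d) ∧
        -- the isomorphism is the canonical one, induced by the product of `Sym W`
        (∀ (U : M.affineOpens) (a : Fin q → (bundleChart i W L ε U).ID)
            (w : Fin (p - q) → LinearMap.ker (bundleChart i W L ε U).ε)
            (s : (bundleChart i W L ε U).SymW),
          Φ U ((bundleChart i W L ε U).symε s ⊗ₜ[(bundleChart i W L ε U).B]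
              (symProd (fun j => BundleChart.toN (a j)) ⊗ₜ[(bundleChart i W L ε U).B]
                symProd (fun j => BundleChart.toK (w j)))) =
            BundleChart.grGenerator hq a w s)) := by
  have hφ := fun U => bundleChart_φ_surjective i W L ε U
  have hε := bundleChart_ε_surjective i hW hL ε
  refine ⟨fun U => BundleChart.symε_surjective (hφ U) (hε U),
    fun U => ⟨BundleChart.F_zero p, BundleChart.F_antitone p, fun q h => BundleChart.F_eq_bot h,
      fun q x hx => BundleChart.F_graded p q x hx⟩,
    fun q h U => BundleChart.subsingleton_Gr h, fun q hq => ?_⟩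
  choose Φ hΦ using fun U => bundleChart_exists_iso sM i hW hL ε U hq
  exact ⟨Φ, fun U V h x =>
      (bundleRes i W L ε h).iso_resT hq (hφ U) (hε U) (Φ U) (Φ V) (hΦ U) (hΦ V) x,
    fun U s x => BundleChart.iso_smul hq (Φ U) (hφ U) (hε U) (hΦ U) s x,
    fun U d x => BundleChart.iso_mem_GrDeg hq (Φ U) (hφ U) (hε U) (hΦ U) d x,
    fun U a w s => hΦ U a w s⟩

end
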